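/- Let $L>0$, $h\in\mathbb{C}$, and let $q:[0,L]\to\mathbb{C}$ belong to $W_2^1[0,L]$, i.e. $q$ is absolutely continuous with $q'\in\mathcal{L}_2[0,L]$. For $\rho\in\mathbb{C}$ let $S(\rho,\cdot)$ and $\phi(\rho,\cdot)$ be the solutions of $-y''+q(x)y=\rho^2y$ on $(0,L)$ with $S(\rho,0)=0$, $S'(\rho,0)=1$ and $\phi(\rho,0)=1$, $\phi'(\rho,0)=h$, and put $\omega(x)=\frac12\int_0^x q(s)\,ds$. Let $\mathcal{S}(x,t)$ and $\mathcal{G}(x,t)$, $0\le t\le x\le L$, denote the transmutation kernels, i.e. functions with $\mathcal{S}(x,\cdot),\mathcal{G}(x,\cdot)\in W_2^1[0,x]$ for every $x\in[0,L]$ and \[ S(\rho,x)=\frac{\sin(\rho x)}{\rho}+\frac1\rho\int_0^x\mathcal{S}(x,t)\sin(\rho t)\,dt,\qquad \phi(\rho,x)=\cos(\rho x)+\int_0^x\mathcal{G}(x,t)\cos(\rho t)\,dt \] for all $x\in[0,L]$ and $\rho\in\mathbb{C}$ (where $\sin(\rho t)/\rho$ is read as $t$ for $\rho=0$). Then such kernels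 exist, and for any such kernels and every $x\in[0,L]$ the functions $\mathcal{S}(x,\cdot)$ and $\mathcal{G}(x,\cdot)$ are differentiable on $[0,x]$, their derivatives $\mathcal{S}_2(x,\cdot)$, $\mathcal{G}_2(x,\cdot)$ in $t$ are absolutely continuous on $[0,x]$, the second derivatives $\mathcal{S}_{22}(x,\cdot)$, $\mathcal{G}_{22}(x,\cdot)$ in $t$ (defined a.e.) belong to $\mathcal{L}_2[0,x]$, and for all $\rho\in\mathbb{C}\setminus\{0\}$ \[ S(\rho,x)=\frac{\sin(\rho x)}{\rho}-\frac{\cos(\rho x)}{\rho^{2}}\,\omega(x)+\frac{\sin(\rho x)}{4\rho^{3}}\left(q(x)-2\omega^{2}(x)+q(0)\right)-\frac{1}{\rho^{3}}\int_{0}^{x}\mathcal{S}_{22}(x,t)\sin(\rho t)\,dt, \] \[ \phi(\rho,x)=\cos(\rho x)+\frac{\sin(\rho x)}{\rho}\,(h+\omega(x))+\frac{\cos(\rho x)}{4\rho^{2}}\left(q(x)-4h\,\omega(x)-2\omega^{2}(x)-q(0)\right)-\frac{1}{\rho^{2}}\int_{0}^{x}\mathcal{G}_{22}(x,t)\cos(\rho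 t)\,dt. \] -/

import Mathlib

open Set MeasureTheory

noncomputable section

namespace SturmLiouville

/-- `f` is absolutely continuous on `[a, b]` and its derivative is (a.e.) the square integrable
function `g`. -/
def HasL2Deriv (a b : ℝ) (f g : ℝ → ℂ) : Prop :=
  MemLp g 2 (volume.restrict (Icc a b)) ∧
    ∀ x ∈ Icc a b, f x = f a + ∫ t in a..x, g t

/-- The Sobolev space `W₂¹[a, b]`; `f` is the absolutely continuous representative, so that its
point values are meaningful. -/
def MemW21 (a b : ℝ) (f : ℝ → ℂ) : Prop :=
  ∃ g : ℝ → ℂ, HasL2Deriv a b f g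

/-- `y` is the solution of `-y'' + q y = ρ² y` on `(0, L)`, continuously differentiable up to the
end points, with the initial values `y(0) = y₀`, `y'(0) = y₁`. -/
def IsSolution (L : ℝ) (q : ℝ → ℂ) (ρ y₀ y₁ : ℂ) (y : ℝ → ℂ) : Prop :=
  ∃ dy ddy : ℝ → ℂ,
    (∀ x ∈ Icc 0 L, HasDerivWithinAt y (dy x) (Icc 0 L) x) ∧
    ContinuousOn dy (Icc 0 L) ∧
    (∀ x ∈ Ioo 0 L, HasDerivAt dy (ddy x) x) ∧
    (∀ x ∈ Ioo 0 L, -ddy x + q x * y x = ρ ^ 2 * y x) ∧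
    y 0 = y₀ ∧ dy 0 = y₁

/-- `ω(x) = (1/2) ∫₀ˣ q(s) ds`. -/
def omega (q : ℝ → ℂ) (x : ℝ) : ℂ :=
  (1 / 2) * ∫ s in (0 : ℝ)..x, q s

/-- The entire function `ρ ↦ sin(ρ t) / ρ`, with its value `t` at `ρ = 0`. -/
def sinDiv (ρ : ℂ) (t : ℝ) : ℂ :=
  if ρ = 0 then (t : ℂ) else Complex.sin (ρ * t) / ρ

/-- `K` is the transmutation kernel of the family of solutions `S(ρ, x)`:
`S(ρ, x) = sin(ρ x)/ρ + ∫₀ˣ K(x, t) sin(ρ t)/ρ dt` for all complex `ρ`. -/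
def IsSineKernel (L : ℝ) (S : ℂ → ℝ → ℂ) (K : ℝ → ℝ → ℂ) : Prop :=
  ∀ x ∈ Icc 0 L, MemW21 0 x (K x) ∧
    ∀ ρ : ℂ, S ρ x = sinDiv ρ x + ∫ t in (0 : ℝ)..x, K x t * sinDiv ρ t

/-- `K` is the transmutation kernel of the family of solutions `φ(ρ, x)`:
`φ(ρ, x) = cos(ρ x) + ∫₀ˣ K(x, t) cos(ρ t) dt` for all complex `ρ`. -/
def IsCosineKernel (L : ℝ) (φ : ℂ → ℝ → ℂ) (K : ℝ → ℝ → ℂ) : Prop :=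
  ∀ x ∈ Icc 0 L, MemW21 0 x (K x) ∧
    ∀ ρ : ℂ, φ ρ x = Complex.cos (ρ * x) + ∫ t in (0 : ℝ)..x, K x t * Complex.cos (ρ * t)

/-- The partial derivative `K₂(x, t)` in the second argument of a kernel defined for
`0 ≤ t ≤ x` (one-sided at `t = 0` and `t = x`). -/
def partial2 (K : ℝ → ℝ → ℂ) (x t : ℝ) : ℂ :=
  derivWithin (K x) (Icc 0 x) t

/-- The second partial derivative `K₂₂(x, t)`. -/
def partial22 (K : ℝ → ℝ → ℂ) : ℝ → ℝ → ℂ :=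
  partial2 (partial2 K)

end SturmLiouville

end

/-! Extend the potential continuously and boundedly to the line. In characteristic coordinates a =
(x + t)/2, b = (x - t)/2 the kernel of the transmutation operator solves a Goursat problem k_ab =
q(a + b) k, with k = ω on b = 0 and k = 0 on a = 0. Its integral form has a continuous solution by
contraction in an exponentially weighted sup norm. The operator θ ↦ θ + ∫_{-x}^{x} K(x, t) θ(t) dt
carries solutions of θ'' = μθ to solutions of y'' = (q + μ)y (`hasDerivAt_transmutation`). Applied
to sin(ρt)/ρ and cos(ρt) it gives a fundamental system. The sine kernel is thus twice the odd part
of K in t, and the cosine kernel for h = 0 twice the even part. An integration by parts absorbs the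
term h S into a cosine kernel.

The extra smoothness comes from `exists_hasDerivAt_remainder`: along a + b = x the derivative of k
is q(a)/2 plus a C¹ function. Hence the t-derivatives of both kernels are as regular as q, namely
W₂¹.

Kernels are unique for x > 0, because a continuous function on [0, x] orthogonal to all sin(ρt), or
to all cos(ρt), vanishes by Weierstrass approximation. So any given kernel is the constructed one,
and two integrations by parts give the expansions. The boundary terms at t = x are explicit, since k
and its derivative are known on the characteristics; those at t = 0 vanish by parity. -/

noncomputable section

namespace SturmLiouville

/-! ### The Goursat problem by contraction -/

theorem norm_integral_le_exp {F : ℝ → ℂ} {C M : ℝ} (hM : 0 < M) (hC : 0 ≤ C)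
    (hF : ∀ s, ‖F s‖ ≤ C * Real.exp (M * |s|)) (a : ℝ) :
    ‖∫ s in (0 : ℝ)..a, F s‖ ≤ C * Real.exp (M * |a|) / M := by
  have key : ∀ G : ℝ → ℂ, (∀ s, ‖G s‖ ≤ C * Real.exp (M * |s|)) → ∀ a : ℝ, 0 ≤ a →
      ‖∫ s in (0 : ℝ)..a, G s‖ ≤ C * Real.exp (M * |a|) / M := by
    intro G hG a ha
    have h1 : ‖∫ s in (0 : ℝ)..a, G s‖ ≤ ∫ s in (0 : ℝ)..a, C * Real.exp (M * s) := by
      refine intervalIntegral.norm_integral_le_of_norm_le ha (ae_of_all _ fun s hs => ?_)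
        (Continuous.intervalIntegrable (by fun_prop) _ _)
      simpa [abs_of_pos hs.1] using hG s
    have h2 : ∫ s in (0 : ℝ)..a, C * Real.exp (M * s) =
        C * Real.exp (M * a) / M - C * Real.exp (M * 0) / M := by
      refine intervalIntegral.integral_eq_sub_of_hasDerivAt
        (f := fun s => C * Real.exp (M * s) / M) (fun s _ => ?_)
        (Continuous.intervalIntegrable (by fun_prop) _ _)
      have := (((hasDerivAt_id s).const_mul M).exp.const_mul C).div_const M
      refine this.congr_deriv ?_
      simp only [id]; field_simp
    rw [h2] at h1
    have h3 : 0 ≤ C * Real.exp (M * 0) / M := by positivity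
    rw [abs_of_nonneg ha]
    linarith
  rcases le_total 0 a with ha | ha
  · exact key F hF a ha
  · have h1 := key (fun s => F (-s)) (fun s => by simpa using hF (-s)) (-a) (by linarith)
    rw [intervalIntegral.integral_comp_neg (fun s => F s), neg_neg, neg_zero,
      intervalIntegral.integral_symm, norm_neg, abs_neg] at h1
    exact h1

/-- The Goursat problem `k_ab = q(a + b) k`, `k(a, 0) = f(a)`, `k(0, b) = f(0)` has a continuous
solution on the plane. -/
theorem exists_goursat {q f : ℝ → ℂ} (hq : Continuous q) {Q : ℝ} (hQ : ∀ s, ‖q s‖ ≤ Q)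
    (hf : Continuous f) {C M₀ : ℝ} (hfC : ∀ M, M₀ ≤ M → ∀ a, ‖f a‖ ≤ C * Real.exp (M * |a|)) :
    ∃ k : ℝ → ℝ → ℂ, Continuous (Function.uncurry k) ∧
      ∀ a b, k a b = f a + ∫ α in (0 : ℝ)..a, ∫ β in (0 : ℝ)..b, q (α + β) * k α β := by
  have hQ0 : 0 ≤ Q := (norm_nonneg _).trans (hQ 0)
  -- Each integration against the weight exp(M|·|) gains a factor 1/M, so the double integral
  -- operator has weighted norm at most Q/M². This M makes it a contraction with constant 1/2.
  obtain ⟨M, hM0, hMM, hMQ⟩ : ∃ M : ℝ, 0 < M ∧ M₀ ≤ M ∧ Q / M / M ≤ 1 / 2 := by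
    refine ⟨max M₀ (2 * Q + 1), lt_of_lt_of_le (by linarith) (le_max_right _ _),
      le_max_left _ _, ?_⟩
    set M := max M₀ (2 * Q + 1)
    have h : 2 * Q + 1 ≤ M := le_max_right _ _
    rw [div_div, div_le_div_iff₀ (by nlinarith) two_pos]
    nlinarith
  have hC : 0 ≤ C := by
    have h := (norm_nonneg _).trans (hfC M hMM 0)
    have := Real.exp_pos (M * |(0 : ℝ)|)
    by_contra hc
    nlinarith
  let w : ℝ → ℝ → ℝ := fun a b => Real.exp (M * |a|) * Real.exp (M * |b|)
  have hw : Continuous (Function.uncurry w) := by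
    simp only [w, Function.uncurry_def]; fun_prop
  have hwpos : ∀ a b, 0 < w a b := fun a b => by positivity
  have hw1 : ∀ a b, Real.exp (M * |a|) ≤ w a b := fun a b =>
    le_mul_of_one_le_right (Real.exp_pos _).le (Real.one_le_exp (by positivity))
  let I : (ℝ → ℝ → ℂ) → ℝ → ℝ → ℂ := fun g a b =>
    ∫ α in (0 : ℝ)..a, ∫ β in (0 : ℝ)..b, q (α + β) * g α β
  have hIc : ∀ g : ℝ → ℝ → ℂ, Continuous (Function.uncurry g) →
      Continuous (Function.uncurry (I g)) := by
    intro g hg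
    have : Continuous fun p : ℝ × ℝ => g p.1 p.2 := hg
    simp only [I, Function.uncurry_def]
    fun_prop
  have hIb : ∀ (g : ℝ → ℝ → ℂ) (B : ℝ), 0 ≤ B → (∀ a b, ‖g a b‖ ≤ B * w a b) →
      ∀ a b, ‖I g a b‖ ≤ 1 / 2 * B * w a b := by
    intro g B hB hg a b
    have h := norm_integral_le_exp (C := Q * B * Real.exp (M * |b|) / M) hM0 (by positivity)
      (F := fun α => ∫ β in (0 : ℝ)..b, q (α + β) * g α β) (fun α => ?_) a
    · refine h.trans (le_trans (le_of_eq ?_)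
        (mul_le_mul_of_nonneg_right hMQ (mul_nonneg hB (hwpos a b).le)) |>.trans
          (le_of_eq (by ring)))
      simp only [w]; ring
    · refine (norm_integral_le_exp (C := Q * B * Real.exp (M * |α|)) hM0 (by positivity)
        (fun β => ?_) b).trans (le_of_eq (by ring))
      rw [norm_mul]
      refine (mul_le_mul (hQ _) (hg α β) (norm_nonneg _) hQ0).trans (le_of_eq ?_)
      simp only [w]; ring
  -- The fixed point is sought for the bounded function u = k / w, so that the weighted norm becomes
  -- the usual sup norm.
  let E := BoundedContinuousFunction (ℝ × ℝ) ℂ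
  let g : E → ℝ → ℝ → ℂ := fun u a b => w a b * u (a, b)
  have hgc : ∀ u, Continuous (Function.uncurry (g u)) := fun u => by
    have : Continuous fun p : ℝ × ℝ => w p.1 p.2 := hw
    simp only [g, Function.uncurry_def]
    fun_prop
  have hgb : ∀ (u : E) a b, ‖g u a b‖ ≤ ‖u‖ * w a b := fun u a b => by
    simp only [g, norm_mul, Complex.norm_real, Real.norm_eq_abs, abs_of_pos (hwpos a b)]
    rw [mul_comm]
    exact mul_le_mul_of_nonneg_right (u.norm_coe_le_norm _) (hwpos a b).le
  let T : E → E := fun u => BoundedContinuousFunction.ofNormedAddCommGroup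
    (fun p : ℝ × ℝ => ((w p.1 p.2)⁻¹ : ℝ) * (f p.1 + I (g u) p.1 p.2))
    (by
      have h1 : Continuous fun p : ℝ × ℝ => (w p.1 p.2)⁻¹ :=
        Continuous.inv₀ hw fun p => (hwpos p.1 p.2).ne'
      have h2 : Continuous fun p : ℝ × ℝ => I (g u) p.1 p.2 := hIc _ (hgc u)
      fun_prop)
    (C + 1 / 2 * ‖u‖)
    (by
      rintro ⟨a, b⟩
      simp only [norm_mul, Complex.norm_real, Real.norm_eq_abs,
        abs_of_pos (inv_pos.2 (hwpos a b))]
      rw [inv_mul_le_iff₀ (hwpos a b)]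
      have h1 := hIb (g u) ‖u‖ (norm_nonneg _) (hgb u) a b
      have h2 := (hfC M hMM a).trans (mul_le_mul_of_nonneg_left (hw1 a b) hC)
      refine (norm_add_le _ _).trans ?_
      linarith)
  have hTa : ∀ u a b, T u (a, b) = ((w a b)⁻¹ : ℝ) * (f a + I (g u) a b) := fun _ _ _ => rfl
  have hT : ContractingWith (1 / 2) T := by
    refine ⟨by norm_num, LipschitzWith.of_dist_le_mul fun u v => ?_⟩
    rw [BoundedContinuousFunction.dist_le (by positivity)]
    rintro ⟨a, b⟩
    have h1 : I (g u) a b - I (g v) a b = I (g (u - v)) a b := by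
      simp only [I]
      have cu : Continuous fun p : ℝ × ℝ => g u p.1 p.2 := hgc u
      have cv : Continuous fun p : ℝ × ℝ => g v p.1 p.2 := hgc v
      rw [← intervalIntegral.integral_sub (Continuous.intervalIntegrable (by fun_prop) _ _)
        (Continuous.intervalIntegrable (by fun_prop) _ _)]
      refine intervalIntegral.integral_congr fun α _ => ?_
      rw [← intervalIntegral.integral_sub (Continuous.intervalIntegrable (by fun_prop) _ _)
        (Continuous.intervalIntegrable (by fun_prop) _ _)]
      refine intervalIntegral.integral_congr fun β _ => ?_
      change _ = q (α + β) * (w α β * (u (α, β) - v (α, β)))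
      simp only [g]
      ring
    have h2 := hIb (g (u - v)) ‖u - v‖ (norm_nonneg _) (hgb _) a b
    have h3 : T u (a, b) - T v (a, b) = ((w a b)⁻¹ : ℝ) * I (g (u - v)) a b := by
      rw [hTa, hTa, ← h1]; ring
    rw [dist_eq_norm, h3, norm_mul, Complex.norm_real, Real.norm_eq_abs,
      abs_of_pos (inv_pos.2 (hwpos a b)), inv_mul_le_iff₀ (hwpos a b), dist_eq_norm]
    push_cast
    linarith
  have hfix := hT.fixedPoint_isFixedPt
  set u := hT.fixedPoint
  refine ⟨g u, hgc u, fun a b => ?_⟩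
  have h1 : T u (a, b) = u (a, b) := by rw [hfix.eq]
  rw [hTa] at h1
  have h2 : (w a b : ℂ) ≠ 0 := by exact_mod_cast (hwpos a b).ne'
  change (w a b : ℂ) * u (a, b) = f a + I (g u) a b
  rw [← h1]
  push_cast
  field_simp

/-! ### Derivatives of the Goursat kernel -/

/-- Leibniz rule for an integral whose upper limit is the parameter. -/
theorem hasDerivAt_integral_diag {F F' : ℝ → ℝ → ℂ} (hF : Continuous (Function.uncurry F))
    (hF' : Continuous (Function.uncurry F')) (hd : ∀ s x, HasDerivAt (F s) (F' s x) x) (c x : ℝ) :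
    HasDerivAt (fun x => ∫ s in c..x, F s x) (F x x + ∫ s in c..x, F' s x) x := by
  have cF : Continuous fun p : ℝ × ℝ => F p.1 p.2 := hF
  have cF' : Continuous fun p : ℝ × ℝ => F' p.1 p.2 := hF'
  -- Separate the two roles of x: both partial derivatives of f are continuous, so f is
  -- differentiable, and the chain rule applies along the diagonal u = v = x.
  let f : ℝ → ℝ → ℂ := fun u v => ∫ s in c..u, F s v
  let f₁ : ℝ → ℝ → ℝ →L[ℝ] ℂ := fun u v => ContinuousLinearMap.toSpanSingleton ℝ (F u v)
  let f₂ : ℝ → ℝ → ℝ →L[ℝ] ℂ := fun u v =>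
    ContinuousLinearMap.toSpanSingleton ℝ (∫ s in c..u, F' s v)
  have c₁ : Continuous (Function.uncurry f₁) :=
    (ContinuousLinearMap.toSpanSingletonLIE ℝ ℂ).continuous.comp hF
  have c₂ : Continuous (Function.uncurry f₂) := by
    refine (ContinuousLinearMap.toSpanSingletonLIE ℝ ℂ).continuous.comp
      (g := fun w => _) (f := fun p : ℝ × ℝ => ∫ s in c..p.1, F' s p.2) ?_
    fun_prop
  have d₁ : ∀ v : ℝ × ℝ, HasFDerivAt (fun z => f z v.2) (f₁ v.1 v.2) v.1 := fun v =>
    (intervalIntegral.integral_hasDerivAt_right (Continuous.intervalIntegrable (by fun_prop) _ _)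
      (Continuous.stronglyMeasurableAtFilter (by fun_prop) _ _)
      (Continuous.continuousAt (by fun_prop))).hasFDerivAt
  have d₂ : ∀ v : ℝ × ℝ, HasFDerivAt (fun z => f v.1 z) (f₂ v.1 v.2) v.2 := by
    rintro ⟨a, b⟩
    obtain ⟨B, hB⟩ := ((isCompact_uIcc (a := c) (b := a)).prod
      (isCompact_Icc (a := b - 1) (b := b + 1))).exists_bound_of_continuousOn cF'.continuousOn
    refine (intervalIntegral.hasDerivAt_integral_of_dominated_loc_of_deriv_le
      (F := fun z s => F s z) (F' := fun z s => F' s z) (bound := fun _ => B)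
      (Icc_mem_nhds (by linarith : b - 1 < b) (by linarith : b < b + 1))
      (Filter.Eventually.of_forall fun z => Continuous.aestronglyMeasurable (by fun_prop))
      (Continuous.intervalIntegrable (by fun_prop) _ _)
      (Continuous.aestronglyMeasurable (by fun_prop))
      (ae_of_all _ fun s hs z hz => hB (s, z) ⟨uIoc_subset_uIcc hs, hz⟩)
      intervalIntegrable_const
      (ae_of_all _ fun s hs z hz => hd s z)).2.hasFDerivAt
  have h := (hasStrictFDerivAt_uncurry_coprod (u := (x, x)) (f := f) (f₁ := f₁) (f₂ := f₂)
    (Filter.Eventually.of_forall d₁) (Filter.Eventually.of_forall d₂)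
    c₁.continuousAt c₂.continuousAt).hasFDerivAt
  have h2 := HasFDerivAt.comp_hasDerivAt (f := fun z : ℝ => (z, z)) x h
    ((hasDerivAt_id x).prodMk (hasDerivAt_id x))
  refine h2.congr_deriv ?_
  simp [f₁, f₂, Function.HasUncurry.uncurry]

/-- `k` is the kernel of the transmutation operator of `-y'' + q y` in characteristic
coordinates `a = (x + t) / 2`, `b = (x - t) / 2`. -/
structure IsGoursatKernel (q : ℝ → ℂ) (k : ℝ → ℝ → ℂ) : Prop where
  continuous_potential : Continuous q
  continuous_kernel : Continuous fun p : ℝ × ℝ => k p.1 p.2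
  eq : ∀ a b, k a b = 1 / 2 * (∫ s in (0 : ℝ)..a, q s) +
    ∫ α in (0 : ℝ)..a, ∫ β in (0 : ℝ)..b, q (α + β) * k α β

/-- The datum ω grows at most linearly, and |a| ≤ exp(M|a|) as soon as M ≥ 1. -/
theorem exists_isGoursatKernel {q : ℝ → ℂ} (hq : Continuous q) {Q : ℝ} (hQ : ∀ s, ‖q s‖ ≤ Q) :
    ∃ k, IsGoursatKernel q k := by
  have hQ0 : 0 ≤ Q := (norm_nonneg _).trans (hQ 0)
  obtain ⟨k, hk, he⟩ := exists_goursat (f := fun a => 1 / 2 * ∫ s in (0 : ℝ)..a, q s) hq hQ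
    (by fun_prop) (C := Q) (M₀ := 1) (fun M hM a => by
      have h1 := intervalIntegral.norm_integral_le_of_norm_le_const (a := 0) (b := a)
        (f := q) (C := Q) (fun s _ => hQ s)
      rw [sub_zero] at h1
      have h2 : |a| ≤ Real.exp (M * |a|) := by
        have := Real.add_one_le_exp (M * |a|)
        nlinarith [abs_nonneg a]
      have h3 := mul_le_mul_of_nonneg_left h2 hQ0
      rw [norm_mul]
      have h4 : ‖(1 / 2 : ℂ)‖ = 1 / 2 := by norm_num
      rw [h4]
      have := norm_nonneg (∫ s in (0 : ℝ)..a, q s)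
      linarith)
  exact ⟨k, hq, hk, he⟩

/-- The partial derivative in `a` of a kernel in characteristic coordinates. -/
def goursatFst (q : ℝ → ℂ) (k : ℝ → ℝ → ℂ) (a b : ℝ) : ℂ :=
  1 / 2 * q a + ∫ β in (0 : ℝ)..b, q (a + β) * k a β

/-- The partial derivative in `b` of a kernel in characteristic coordinates. -/
def goursatSnd (q : ℝ → ℂ) (k : ℝ → ℝ → ℂ) (a b : ℝ) : ℂ :=
  ∫ α in (0 : ℝ)..a, q (α + b) * k α b

theorem hasDerivAt_integral_of_continuous {f : ℝ → ℂ} (hf : Continuous f) (c x : ℝ) :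
    HasDerivAt (fun x => ∫ s in c..x, f s) (f x) x :=
  intervalIntegral.integral_hasDerivAt_right (hf.intervalIntegrable _ _)
    (hf.stronglyMeasurableAtFilter _ _) hf.continuousAt

namespace IsGoursatKernel

variable {q : ℝ → ℂ} {k : ℝ → ℝ → ℂ}

theorem continuous_fst (hk : IsGoursatKernel q k) :
    Continuous fun p : ℝ × ℝ => goursatFst q k p.1 p.2 := by
  have h1 := hk.continuous_potential
  have h2 := hk.continuous_kernel
  unfold goursatFst
  fun_prop

theorem continuous_snd (hk : IsGoursatKernel q k) :
    Continuous fun p : ℝ × ℝ => goursatSnd q k p.1 p.2 := by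
  have h1 := hk.continuous_potential
  have h2 := hk.continuous_kernel
  unfold goursatSnd
  fun_prop

theorem hasDerivAt_fst (hk : IsGoursatKernel q k) (a b : ℝ) :
    HasDerivAt (fun a => k a b) (goursatFst q k a b) a := by
  have h1 := hk.continuous_potential
  have h2 := hk.continuous_kernel
  have h3 : (fun a => k a b) = fun a => 1 / 2 * (∫ s in (0 : ℝ)..a, q s) +
      ∫ α in (0 : ℝ)..a, ∫ β in (0 : ℝ)..b, q (α + β) * k α β := funext fun a => hk.eq a b
  rw [h3]
  exact ((hasDerivAt_integral_of_continuous h1 0 a).const_mul _).add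
    (hasDerivAt_integral_of_continuous
      (f := fun α => ∫ β in (0 : ℝ)..b, q (α + β) * k α β) (by fun_prop) 0 a)

theorem hasDerivAt_fst_snd (hk : IsGoursatKernel q k) (a b : ℝ) :
    HasDerivAt (fun b => goursatFst q k a b) (q (a + b) * k a b) b := by
  have h1 := hk.continuous_potential
  have h2 := hk.continuous_kernel
  exact (hasDerivAt_integral_of_continuous (f := fun β => q (a + β) * k a β)
    (by fun_prop) 0 b).const_add _

/-- The Leibniz rule is applied directly to the integral equation, so neither joint
differentiability of k nor a separate proof that `goursatSnd` is its b-derivative is needed. -/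
theorem hasDerivAt_diag (hk : IsGoursatKernel q k) (s a : ℝ) :
    HasDerivAt (fun a => k a (s - a)) (goursatFst q k a (s - a) - goursatSnd q k a (s - a)) a := by
  have h1 := hk.continuous_potential
  have h2 := hk.continuous_kernel
  have h3 : (fun a => k a (s - a)) = fun a => 1 / 2 * (∫ s in (0 : ℝ)..a, q s) +
      ∫ α in (0 : ℝ)..a, ∫ β in (0 : ℝ)..(s - a), q (α + β) * k α β :=
    funext fun a => hk.eq a (s - a)
  rw [h3]
  refine (((hasDerivAt_integral_of_continuous h1 0 a).const_mul _).add
    (hasDerivAt_integral_diag (F := fun α a => ∫ β in (0 : ℝ)..(s - a), q (α + β) * k α β)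
      (F' := fun α a => -(q (α + (s - a)) * k α (s - a))) ?_ ?_ ?_ 0 a)).congr_deriv ?_
  · simp only [Function.uncurry_def]; fun_prop
  · simp only [Function.uncurry_def]; fun_prop
  · intro α a
    have := (hasDerivAt_integral_of_continuous (f := fun β => q (α + β) * k α β)
      (by fun_prop) 0 (s - a)).comp_const_sub s a
    exact this
  · simp only [goursatFst, goursatSnd, intervalIntegral.integral_neg]
    ring

theorem apply_zero_right (hk : IsGoursatKernel q k) (a : ℝ) : k a 0 = omega q a := by
  rw [hk.eq]; simp [omega]

theorem apply_zero_left (hk : IsGoursatKernel q k) (b : ℝ) : k 0 b = 0 := by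
  rw [hk.eq]; simp

theorem goursatFst_zero_right (a : ℝ) : goursatFst q k a 0 = 1 / 2 * q a := by
  simp [goursatFst]

theorem goursatFst_zero_left (hk : IsGoursatKernel q k) (b : ℝ) :
    goursatFst q k 0 b = 1 / 2 * q 0 := by
  simp [goursatFst, hk.apply_zero_left]

theorem goursatSnd_zero_left (b : ℝ) : goursatSnd q k 0 b = 0 := by
  simp [goursatSnd]

/-- On b = 0 the integrand is qω = (ω²)', because ω' = q/2. -/
theorem goursatSnd_zero_right (hk : IsGoursatKernel q k) (a : ℝ) :
    goursatSnd q k a 0 = omega q a ^ 2 := by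
  have h1 := hk.continuous_potential
  have hc : Continuous (omega q) := by unfold omega; fun_prop
  have h2 : ∀ s, HasDerivAt (fun s => omega q s ^ 2) (q s * omega q s) s := fun s => by
    have h := ((hasDerivAt_integral_of_continuous h1 0 s).const_mul (1 / 2 : ℂ)).pow 2
    refine h.congr_deriv ?_
    simp only [omega, Nat.cast_ofNat]
    ring
  simp only [goursatSnd, add_zero, hk.apply_zero_right]
  rw [intervalIntegral.integral_eq_sub_of_hasDerivAt (fun s _ => h2 s)
    (Continuous.intervalIntegrable (by fun_prop) _ _)]
  simp [omega]

/-! ### The transmutation operator -/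

/-- The transmutation operator maps solutions of `θ'' = μ θ` to solutions of
`y'' = (q + μ) y`. -/
theorem hasDerivAt_transmutation (hk : IsGoursatKernel q k) {μ : ℂ} {θ θ' : ℝ → ℂ}
    (hθ : ∀ t, HasDerivAt θ (θ' t) t) (hθ' : ∀ t, HasDerivAt θ' (μ * θ t) t) (x : ℝ) :
    HasDerivAt (fun x => θ x + 2 * ∫ a in (0 : ℝ)..x, k a (x - a) * θ (2 * a - x))
      (θ' x + 2 * ∫ a in (0 : ℝ)..x,
        (goursatFst q k a (x - a) * θ (2 * a - x) + k a (x - a) * θ' (2 * a - x))) x ∧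
    HasDerivAt (fun x => θ' x + 2 * ∫ a in (0 : ℝ)..x,
        (goursatFst q k a (x - a) * θ (2 * a - x) + k a (x - a) * θ' (2 * a - x)))
      ((q x + μ) * (θ x + 2 * ∫ a in (0 : ℝ)..x, k a (x - a) * θ (2 * a - x))) x := by
  have h1 := hk.continuous_potential
  have h2 := hk.continuous_kernel
  have h3 := hk.continuous_fst
  have c : Continuous θ := continuous_iff_continuousAt.2 fun t => (hθ t).continuousAt
  have c' : Continuous θ' := continuous_iff_continuousAt.2 fun t => (hθ' t).continuousAt
  have flip : ∀ (G : ℝ → ℝ → ℝ → ℂ) (x : ℝ), ∫ a in (0 : ℝ)..x, G a (x - a) (2 * a - x) =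
      ∫ b in (0 : ℝ)..x, G (x - b) b (x - 2 * b) := fun G x => by
    have := intervalIntegral.integral_comp_sub_left (a := 0) (b := x)
      (fun b => G (x - b) b (x - 2 * b)) x
    simp only [sub_self, sub_zero, sub_sub_cancel] at this
    rw [← this]
    refine intervalIntegral.integral_congr fun a _ => ?_
    congr 1
    ring
  have reflect : ∀ s x : ℝ, HasDerivAt (fun x => θ (2 * s - x)) (-θ' (2 * s - x)) x :=
    fun s x => (hθ (2 * s - x)).comp_const_sub (2 * s) x
  -- After the substitution b = x - a the variable x enters only the first argument of k, so only
  -- k_a appears. The boundary term contains k(0, x) = 0.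
  have move : ∀ {η η' : ℝ → ℂ}, Continuous η → Continuous η' → (∀ t, HasDerivAt η (η' t) t) →
      ∀ x : ℝ, HasDerivAt (fun x => ∫ a in (0 : ℝ)..x, k a (x - a) * η (2 * a - x))
        (∫ a in (0 : ℝ)..x, (goursatFst q k a (x - a) * η (2 * a - x) +
          k a (x - a) * η' (2 * a - x))) x := by
    intro η η' cη cη' hη x
    have e1 := funext fun x => flip (fun a b t => k a b * η t) x
    have e2 := flip (fun a b t => goursatFst q k a b * η t + k a b * η' t) x
    rw [e1, e2]
    refine (hasDerivAt_integral_diag (F := fun b x => k (x - b) b * η (x - 2 * b))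
      (F' := fun b x => goursatFst q k (x - b) b * η (x - 2 * b) + k (x - b) b * η' (x - 2 * b))
      ?_ ?_ ?_ 0 x).congr_deriv ?_
    · simp only [Function.uncurry_def]; fun_prop
    · simp only [Function.uncurry_def]; fun_prop
    · exact fun b x => ((hk.hasDerivAt_fst (x - b) b).comp_sub_const x b).mul
        ((hη (x - 2 * b)).comp_sub_const x (2 * b))
    · simp [hk.apply_zero_left]
  refine ⟨(hθ x).add ((move c c' hθ x).const_mul 2), ?_⟩
  have e : (fun x => θ' x + 2 * ∫ a in (0 : ℝ)..x,
      (goursatFst q k a (x - a) * θ (2 * a - x) + k a (x - a) * θ' (2 * a - x))) =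
      fun x => θ' x + 2 * ((∫ a in (0 : ℝ)..x, goursatFst q k a (x - a) * θ (2 * a - x)) +
        ∫ a in (0 : ℝ)..x, k a (x - a) * θ' (2 * a - x)) := by
    funext x
    rw [← intervalIntegral.integral_add (Continuous.intervalIntegrable (by fun_prop) _ _)
      (Continuous.intervalIntegrable (by fun_prop) _ _)]
  -- Here a is held fixed instead, so that k_a is differentiated in b and yields qk. The derivative
  -- k_aa, which need not exist, is avoided. The boundary term is q(x)θ(x)/2.
  have d1 : HasDerivAt (fun x => ∫ a in (0 : ℝ)..x, goursatFst q k a (x - a) * θ (2 * a - x))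
      (goursatFst q k x (x - x) * θ (2 * x - x) + ∫ a in (0 : ℝ)..x,
        (q (a + (x - a)) * k a (x - a) * θ (2 * a - x) +
          goursatFst q k a (x - a) * -θ' (2 * a - x))) x := by
    refine hasDerivAt_integral_diag (F := fun a x => goursatFst q k a (x - a) * θ (2 * a - x))
      (F' := fun a x => q (a + (x - a)) * k a (x - a) * θ (2 * a - x) +
        goursatFst q k a (x - a) * -θ' (2 * a - x)) ?_ ?_ ?_ 0 x
    · simp only [Function.uncurry_def]; fun_prop
    · simp only [Function.uncurry_def]; fun_prop
    · exact fun a x => ((hk.hasDerivAt_fst_snd a (x - a)).comp_sub_const x a).mul (reflect a x)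
  have d2 := move c' (by fun_prop) hθ' x
  rw [e]
  refine ((hθ' x).add ((d1.add d2).const_mul 2)).congr_deriv ?_
  rw [sub_self, goursatFst_zero_right, add_assoc (_ * _ : ℂ),
    ← intervalIntegral.integral_add (Continuous.intervalIntegrable (by fun_prop) _ _)
      (Continuous.intervalIntegrable (by fun_prop) _ _)]
  -- The two terms with k_a θ' cancel, and on the line of integration q(a + b) = q(x).
  have e3 : ∫ a in (0 : ℝ)..x, (q (a + (x - a)) * k a (x - a) * θ (2 * a - x) +
      goursatFst q k a (x - a) * -θ' (2 * a - x) + (goursatFst q k a (x - a) * θ' (2 * a - x) +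
        k a (x - a) * (μ * θ (2 * a - x)))) =
      (q x + μ) * ∫ a in (0 : ℝ)..x, k a (x - a) * θ (2 * a - x) := by
    rw [← intervalIntegral.integral_const_mul]
    refine intervalIntegral.integral_congr fun a _ => ?_
    simp only [add_sub_cancel]
    ring
  rw [e3, show 2 * x - x = x by ring]
  ring

/-- The kernel in the original coordinates. -/
theorem transmutation_eq (hk : IsGoursatKernel q k) {θ : ℝ → ℂ} (hθ : Continuous θ) (x : ℝ) :
    2 * ∫ a in (0 : ℝ)..x, k a (x - a) * θ (2 * a - x) =
      ∫ t in (0 : ℝ)..x, (k ((x + t) / 2) ((x - t) / 2) * θ t +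
        k ((x - t) / 2) ((x + t) / 2) * θ (-t)) := by
  have h2 := hk.continuous_kernel
  let f : ℝ → ℂ := fun t => k ((x + t) / 2) ((x - t) / 2) * θ t
  have hf : Continuous f := by simp only [f]; fun_prop
  have h3 := intervalIntegral.smul_integral_comp_mul_sub (a := 0) (b := x) f 2 x
  have h4 : ∫ a in (0 : ℝ)..x, f (2 * a - x) =
      ∫ a in (0 : ℝ)..x, k a (x - a) * θ (2 * a - x) := by
    refine intervalIntegral.integral_congr fun a _ => ?_
    simp only [f]
    congr 2 <;> ring
  rw [h4] at h3
  have h5 : ∫ t in (0 : ℝ)..x, f (-t) = ∫ t in (-x)..0, f t := by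
    simp
  -- The substitution t = 2a - x turns the integral into one over [-x, x]; its negative half is then
  -- folded onto [0, x].
  have h6 : (2 : ℂ) * ∫ a in (0 : ℝ)..x, k a (x - a) * θ (2 * a - x) =
      ∫ t in (-x)..x, f t := by
    rw [← Complex.ofReal_ofNat, ← Complex.real_smul, h3]
    congr 1 <;> ring
  rw [h6, ← intervalIntegral.integral_add_adjacent_intervals
    (hf.intervalIntegrable (-x) 0) (hf.intervalIntegrable 0 x), ← h5, add_comm,
    ← intervalIntegral.integral_add (hf.intervalIntegrable _ _)
      (Continuous.intervalIntegrable (by fun_prop) _ _)]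
  refine intervalIntegral.integral_congr fun t _ => ?_
  simp only [f, sub_neg_eq_add, ← sub_eq_add_neg]

/-- On the line `a + b = x`, the transversal derivative of the kernel is half the potential up to
a continuously differentiable function. -/
theorem exists_hasDerivAt_remainder (hk : IsGoursatKernel q k) (x : ℝ) :
    ∃ R R' : ℝ → ℂ, Continuous R' ∧ (∀ a, HasDerivAt R (R' a) a) ∧
      ∀ a, goursatFst q k a (x - a) - goursatSnd q k a (x - a) = 1 / 2 * q a + R a := by
  have h1 := hk.continuous_potential
  have h2 := hk.continuous_kernel
  have h3 := hk.continuous_fst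
  have h4 := hk.continuous_snd
  let D : ℝ → ℝ → ℂ := fun a b => goursatFst q k a b - goursatSnd q k a b
  have hD : Continuous fun p : ℝ × ℝ => D p.1 p.2 := by simp only [D]; fun_prop
  -- Substituting s = a + β, respectively s = α + b, in `goursatFst` and `goursatSnd` makes the
  -- argument of q the integration variable. The parameter is left only in the limits and in k, so
  -- the integrals are C¹ although q is merely continuous.
  have dA : ∀ a, HasDerivAt (fun a => ∫ s in x..a, q s * k a (s - a))
      (q a * k a (a - a) + ∫ s in x..a, q s * D a (s - a)) a := fun a => by
    refine hasDerivAt_integral_diag (F := fun s a => q s * k a (s - a))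
      (F' := fun s a => q s * D a (s - a)) ?_ ?_ ?_ x a
    · simp only [Function.uncurry_def]; fun_prop
    · simp only [Function.uncurry_def]; fun_prop
    · exact fun s a => (hk.hasDerivAt_diag s a).const_mul _
  have dB : ∀ b, HasDerivAt (fun b => ∫ s in x..b, q s * k (s - b) b)
      (q b * k (b - b) b + ∫ s in x..b, q s * -D (s - b) b) b := fun b => by
    refine hasDerivAt_integral_diag (F := fun s b => q s * k (s - b) b)
      (F' := fun s b => q s * -D (s - b) b) ?_ ?_ ?_ x b
    · simp only [Function.uncurry_def]; fun_prop
    · simp only [Function.uncurry_def]; fun_prop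
    · intro s b
      have h := (hk.hasDerivAt_diag s (s - b)).comp_const_sub s b
      simp only [sub_sub_cancel] at h
      exact h.const_mul _
  refine ⟨fun a => -(∫ s in x..a, q s * k a (s - a)) +
      ∫ s in x..(x - a), q s * k (s - (x - a)) (x - a),
    fun a => -(q a * k a (a - a) + ∫ s in x..a, q s * D a (s - a)) +
      -(q (x - a) * k (x - a - (x - a)) (x - a) +
        ∫ s in x..(x - a), q s * -D (s - (x - a)) (x - a)), by fun_prop,
    fun a => (dA a).neg.add ((dB (x - a)).comp_const_sub x a), fun a => ?_⟩
  have e1 : ∫ s in x..a, q s * k a (s - a) =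
      -∫ β in (0 : ℝ)..(x - a), q (a + β) * k a β := by
    have h := intervalIntegral.integral_comp_add_left (a := 0) (b := x - a)
      (fun s => q s * k a (s - a)) a
    simp only [add_sub_cancel_left, add_zero, add_sub_cancel] at h
    rw [h, ← intervalIntegral.integral_symm]
  have e2 : ∫ s in x..(x - a), q s * k (s - (x - a)) (x - a) =
      -∫ α in (0 : ℝ)..a, q (α + (x - a)) * k α (x - a) := by
    have h := intervalIntegral.integral_comp_add_right (a := 0) (b := a)
      (fun s => q s * k (s - (x - a)) (x - a)) (x - a)
    simp only [add_sub_cancel_right, zero_add, add_sub_cancel] at h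
    rw [h, ← intervalIntegral.integral_symm]
  simp only [e1, e2, goursatFst, goursatSnd]
  ring

end IsGoursatKernel

/-! ### Calculus of absolutely continuous functions with square integrable derivative -/

namespace HasL2Deriv

variable {a b : ℝ} {f f₁ f₂ g g₁ g₂ : ℝ → ℂ}

theorem integrableOn (hf : HasL2Deriv a b f g) : IntegrableOn g (Icc a b) :=
  hf.1.integrable one_le_two

theorem intervalIntegrable (hf : HasL2Deriv a b f g) {x y : ℝ} (hx : x ∈ Icc a b)
    (hy : y ∈ Icc a b) : IntervalIntegrable g volume x y :=
  (hf.integrableOn.mono_set (uIcc_subset_Icc hx hy)).intervalIntegrable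

theorem sub_eq (hf : HasL2Deriv a b f g) {x y : ℝ} (hx : x ∈ Icc a b) (hy : y ∈ Icc a b) :
    f y - f x = ∫ t in x..y, g t := by
  have ha : a ∈ Icc a b := ⟨le_rfl, hx.1.trans hx.2⟩
  rw [hf.2 x hx, hf.2 y hy, ← intervalIntegral.integral_interval_sub_left
    (hf.intervalIntegrable ha hy) (hf.intervalIntegrable ha hx)]
  ring

theorem add (h₁ : HasL2Deriv a b f₁ g₁) (h₂ : HasL2Deriv a b f₂ g₂) :
    HasL2Deriv a b (fun t => f₁ t + f₂ t) (fun t => g₁ t + g₂ t) := by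
  refine ⟨h₁.1.add h₂.1, fun x hx => ?_⟩
  have ha : a ∈ Icc a b := ⟨le_rfl, hx.1.trans hx.2⟩
  rw [intervalIntegral.integral_add (h₁.intervalIntegrable ha hx) (h₂.intervalIntegrable ha hx),
    add_add_add_comm, ← h₁.2 x hx, ← h₂.2 x hx]

theorem const_mul (c : ℂ) (h : HasL2Deriv a b f g) :
    HasL2Deriv a b (fun t => c * f t) (fun t => c * g t) := by
  refine ⟨h.1.const_mul c, fun x hx => ?_⟩
  rw [intervalIntegral.integral_const_mul, ← mul_add, ← h.2 x hx]

theorem of_hasDerivAt (hg : Continuous g) (h : ∀ t, HasDerivAt f (g t) t) (a b : ℝ) :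
    HasL2Deriv a b f g := by
  refine ⟨?_, fun x _ => ?_⟩
  · obtain ⟨C, hC⟩ := (isCompact_Icc (a := a) (b := b)).exists_bound_of_continuousOn hg.continuousOn
    exact MemLp.of_bound hg.aestronglyMeasurable C
      ((ae_restrict_iff' measurableSet_Icc).2 (ae_of_all _ hC))
  · rw [intervalIntegral.integral_eq_sub_of_hasDerivAt (fun t _ => h t)
      (hg.intervalIntegrable _ _)]
    ring

theorem congr (h : HasL2Deriv a b f₁ g₁) (hf : EqOn f₂ f₁ (Icc a b))
    (hg : g₁ =ᵐ[volume.restrict (Icc a b)] g₂) : HasL2Deriv a b f₂ g₂ := by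
  refine ⟨h.1.ae_eq hg, fun x hx => ?_⟩
  have ha : a ∈ Icc a b := ⟨le_rfl, hx.1.trans hx.2⟩
  rw [hf hx, hf ha, h.2 x hx]
  congr 1
  refine intervalIntegral.integral_congr_ae ?_
  have := (ae_restrict_iff' measurableSet_Icc).1 hg
  filter_upwards [this] with t ht hmem
  exact ht (uIcc_subset_Icc ha hx (uIoc_subset_uIcc hmem))

theorem comp_affine (h : HasL2Deriv a b f g) {c d : ℝ} (hd : d ≠ 0) {l r : ℝ}
    (hm : ∀ t ∈ Icc l r, c + d * t ∈ Icc a b) :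
    HasL2Deriv l r (fun t => f (c + d * t)) (fun t => d * g (c + d * t)) := by
  refine ⟨MemLp.const_mul ?_ _, fun x hx => ?_⟩
  -- Extended by zero to the line, g can be pulled back using the scaling of Lebesgue measure under
  -- an affine map.
  · let G := (Icc a b).indicator g
    have hG : MemLp G 2 volume := (memLp_indicator_iff_restrict measurableSet_Icc).2 h.1
    have hmap : Measure.map (fun t : ℝ => c + d * t) volume =
        ENNReal.ofReal |d⁻¹| • (volume : Measure ℝ) := by
      have : (fun t : ℝ => c + d * t) = (fun t => c + t) ∘ fun t => d * t := rfl
      rw [this, ← Measure.map_map (by fun_prop) (by fun_prop), Real.map_volume_mul_left hd,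
        Measure.map_smul, (measurePreserving_add_left volume c).map_eq]
    have h1 : MemLp (fun t => G (c + d * t)) 2 volume := by
      have h2 : MemLp G 2 (Measure.map (fun t : ℝ => c + d * t) volume) := by
        rw [hmap]; exact hG.smul_measure ENNReal.ofReal_ne_top
      exact h2.comp_of_map (by fun_prop)
    refine (h1.restrict (Icc l r)).ae_eq ?_
    refine (ae_restrict_iff' measurableSet_Icc).2 (ae_of_all _ fun t ht => ?_)
    exact indicator_of_mem (hm t ht) g
  · have hl : l ∈ Icc l r := ⟨le_rfl, hx.1.trans hx.2⟩
    rw [intervalIntegral.integral_const_mul, ← Complex.real_smul,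
      intervalIntegral.smul_integral_comp_add_mul, ← h.sub_eq (hm l hl) (hm x hx)]
    ring

theorem continuousOn (h : HasL2Deriv a b f g) : ContinuousOn f (Icc a b) := by
  refine ContinuousOn.congr ((continuousOn_const (c := f a)).add
    (intervalIntegral.continuousOn_primitive h.integrableOn)) fun x hx => ?_
  rw [h.2 x hx, intervalIntegral.integral_of_le hx.1]
  rfl

/-- This is Lebesgue differentiation. It allows any L² density to be replaced by the pointwise
derivative used in `partial22`. -/
theorem derivWithin_ae_eq (h : HasL2Deriv a b f g) :
    derivWithin f (Icc a b) =ᵐ[volume.restrict (Icc a b)] g := by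
  rcases le_or_gt b a with hab | hab
  · have : volume.restrict (Icc a b) = 0 := by
      rw [Measure.restrict_eq_zero, Real.volume_Icc, ENNReal.ofReal_eq_zero]; linarith
    rw [this]; simp [Filter.EventuallyEq]
  have ha : a ∈ Icc a b := left_mem_Icc.2 hab.le
  have h1 := (h.intervalIntegrable ha (right_mem_Icc.2 hab.le)).ae_hasDerivAt_integral
  rw [Filter.EventuallyEq, ae_restrict_iff' measurableSet_Icc]
  filter_upwards [h1] with x hx hm
  rw [uIcc_of_le hab.le] at hx
  have h2 := ((hx hm a ha).const_add (f a)).hasDerivWithinAt (s := Icc a b)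
  exact (h2.congr h.2 (h.2 x hm)).derivWithin (uniqueDiffOn_Icc hab x hm)

theorem hasL2Deriv_derivWithin (h : HasL2Deriv a b f g) :
    HasL2Deriv a b f (derivWithin f (Icc a b)) :=
  h.congr (fun _ _ => rfl) h.derivWithin_ae_eq.symm

/-- Integration by parts. -/
theorem integral_mul_deriv (h : HasL2Deriv a b f g) (hab : a ≤ b) {v v' : ℝ → ℂ}
    (hv : ∀ t, HasDerivAt v (v' t) t) (hv' : Continuous v') :
    ∫ t in a..b, f t * v' t = f b * v b - f a * v a - ∫ t in a..b, g t * v t := by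
  have ha : a ∈ Icc a b := left_mem_Icc.2 hab
  have hb : b ∈ Icc a b := right_mem_Icc.2 hab
  have hg := h.intervalIntegrable ha hb
  have cv : Continuous v := continuous_iff_continuousAt.2 fun t => (hv t).continuousAt
  -- Since g is only integrable, integration by parts is Fubini for v'(t) g(s) on the triangle t <
  -- s.
  have e1 : ∀ t ∈ Icc a b, f t = f b - ∫ s in a..b, (Ioi t).indicator g s := fun t ht => by
    have h1 := h.sub_eq ht hb
    have h2 : ∫ s in a..b, (Ioi t).indicator g s = ∫ s in t..b, g s := by
      rw [intervalIntegral.integral_of_le hab, intervalIntegral.integral_of_le ht.2,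
        setIntegral_indicator measurableSet_Ioi, Ioc_inter_Ioi, max_eq_right ht.1]
    rw [h2, ← h1]; ring
  let T : Set (ℝ × ℝ) := {p | p.1 < p.2}
  have hT : MeasurableSet T := measurableSet_lt measurable_fst measurable_snd
  let F : ℝ → ℝ → ℂ := fun t s => T.indicator (fun p => v' p.1 * g p.2) (t, s)
  have hF : IntegrableOn F.uncurry (uIoc a b ×ˢ uIoc a b) := by
    have h1 : Integrable (fun p : ℝ × ℝ => v' p.1 * g p.2)
        ((volume.restrict (uIoc a b)).prod (volume.restrict (uIoc a b))) :=
      (intervalIntegrable_iff.1 (hv'.intervalIntegrable a b)).mul_prod (intervalIntegrable_iff.1 hg)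
    rw [Measure.prod_restrict] at h1
    exact h1.indicator hT
  have hswap := intervalIntegral_intervalIntegral_swap hF
  have e2 : ∀ t ∈ Icc a b, ∫ s in a..b, F t s = v' t * (f b - f t) := fun t ht => by
    have h2 : ∀ s, F t s = v' t * (Ioi t).indicator g s := fun s => by
      by_cases hs : t < s <;> simp [F, T, hs]
    simp only [h2]
    rw [intervalIntegral.integral_const_mul, e1 t ht]
    ring
  have e3 : ∀ s ∈ Icc a b, ∫ t in a..b, F t s = g s * (v s - v a) := fun s hs => by
    have h2 : ∀ t, F t s = g s * (Iio s).indicator v' t := fun t => by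
      by_cases ht : t < s <;> simp [F, T, ht, mul_comm]
    simp only [h2]
    rw [intervalIntegral.integral_const_mul, intervalIntegral.integral_of_le hab,
      setIntegral_indicator measurableSet_Iio, ← intervalIntegral.integral_eq_sub_of_hasDerivAt
      (fun t _ => hv t) (hv'.intervalIntegrable _ _), intervalIntegral.integral_of_le hs.1,
      integral_Ioc_eq_integral_Ioo]
    congr 3
    ext t
    simp only [mem_inter_iff, mem_Ioc, mem_Iio, mem_Ioo]
    exact ⟨fun h => ⟨h.1.1, h.2⟩, fun h => ⟨⟨h.1, h.2.le.trans hs.2⟩, h.2⟩⟩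
  rw [intervalIntegral.integral_congr (g := fun t => v' t * (f b - f t))
      fun t ht => e2 t (by rwa [uIcc_of_le hab] at ht),
    intervalIntegral.integral_congr (g := fun s => g s * (v s - v a))
      fun s hs => e3 s (by rwa [uIcc_of_le hab] at hs)] at hswap
  have hfv : IntervalIntegrable (fun t => f t * v' t) volume a b :=
    ContinuousOn.intervalIntegrable (by
      rw [uIcc_of_le hab]; exact h.continuousOn.mul hv'.continuousOn)
  have e4 : ∫ t in a..b, v' t * (f b - f t) = f b * (v b - v a) - ∫ t in a..b, f t * v' t := by
    rw [← intervalIntegral.integral_eq_sub_of_hasDerivAt (fun t _ => hv t)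
      (hv'.intervalIntegrable a b), ← intervalIntegral.integral_const_mul,
      ← intervalIntegral.integral_sub ((hv'.intervalIntegrable a b).const_mul _) hfv]
    refine intervalIntegral.integral_congr fun t _ => ?_
    ring
  have e5 : ∫ s in a..b, g s * (v s - v a) = (∫ s in a..b, g s * v s) - v a * (f b - f a) := by
    rw [h.sub_eq ha hb, ← intervalIntegral.integral_const_mul,
      ← intervalIntegral.integral_sub (hg.mul_continuousOn cv.continuousOn) (hg.const_mul _)]
    refine intervalIntegral.integral_congr fun t _ => ?_
    ring
  rw [e4, e5] at hswap
  linear_combination -hswap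

end HasL2Deriv
theorem MemW21.continuousOn {a b : ℝ} {f : ℝ → ℂ} (h : MemW21 a b f) :
    ContinuousOn f (Icc a b) := by
  obtain ⟨g, hg⟩ := h
  exact hg.continuousOn

/-! ### Completeness of sines and cosines -/

/-- A continuous function on `[0, x]` orthogonal to all powers of `cos (π t / x)` vanishes. -/
theorem eq_zero_of_integral_mul_cos_pow {x : ℝ} (hx : 0 < x) {E : ℝ → ℂ}
    (hE : ContinuousOn E (Icc 0 x))
    (h : ∀ n : ℕ, ∫ t in (0 : ℝ)..x, E t * (Real.cos (Real.pi / x * t) ^ n : ℝ) = 0) :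
    ∀ t ∈ Icc 0 x, E t = 0 := by
  have hEi : IntervalIntegrable E volume 0 x :=
    ContinuousOn.intervalIntegrable (by rwa [uIcc_of_le hx.le])
  have hp : ∀ p : Polynomial ℝ,
      ∫ t in (0 : ℝ)..x, E t * (p.eval (Real.cos (Real.pi / x * t)) : ℝ) = 0 := by
    intro p
    induction p using Polynomial.induction_on' with
    | add p r hp hr =>
      simp only [Polynomial.eval_add, Complex.ofReal_add, mul_add]
      rw [intervalIntegral.integral_add, hp, hr, add_zero] <;>
      exact hEi.mul_continuousOn (Continuous.continuousOn (by fun_prop))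
    | monomial n c =>
      simp only [Polynomial.eval_monomial, Complex.ofReal_mul, mul_left_comm _ (c : ℂ)]
      rw [intervalIntegral.integral_const_mul, h n, mul_zero]
  have hreal : ∀ f : ℝ → ℝ, ContinuousOn f (Icc 0 x) →
      ∫ t in (0 : ℝ)..x, E t * (f t : ℂ) = 0 := by
    intro f hf
    by_contra hne
    have hpos := norm_pos_iff.2 hne
    set B := ∫ t in (0 : ℝ)..x, ‖E t‖
    have hB : 0 ≤ B := intervalIntegral.integral_nonneg hx.le fun t _ => norm_nonneg _
    let ε := ‖∫ t in (0 : ℝ)..x, E t * (f t : ℂ)‖ / (B + 1)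
    have hε : 0 < ε := by positivity
    -- In the variable c = cos(πt/x), which is a bijection of [0, x] onto [-1, 1], Weierstrass
    -- approximation by polynomials applies.
    have harc : ContinuousOn (fun c => f (x / Real.pi * Real.arccos c)) (Icc (-1) 1) := by
      refine hf.comp (Continuous.continuousOn (by fun_prop)) fun c _ => ?_
      refine ⟨mul_nonneg (by positivity) (Real.arccos_nonneg c), ?_⟩
      calc x / Real.pi * Real.arccos c ≤ x / Real.pi * Real.pi :=
            mul_le_mul_of_nonneg_left (Real.arccos_le_pi c) (by positivity)
        _ = x := by field_simp
    obtain ⟨p, hpε⟩ := exists_polynomial_near_of_continuousOn (-1) 1 _ harc ε hε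
    have hclose : ∀ t ∈ Icc 0 x, |p.eval (Real.cos (Real.pi / x * t)) - f t| < ε := by
      intro t ht
      have h1 := hpε (Real.cos (Real.pi / x * t)) ⟨Real.neg_one_le_cos _, Real.cos_le_one _⟩
      rw [Real.arccos_cos (mul_nonneg (by positivity) ht.1) (by
        rw [div_mul_eq_mul_div, div_le_iff₀ hx]
        exact mul_le_mul_of_nonneg_left ht.2 Real.pi_pos.le)] at h1
      have h2 : x / Real.pi * (Real.pi / x * t) = t := by field_simp
      rwa [h2] at h1
    have hfi : IntervalIntegrable (fun t => E t * (f t : ℂ)) volume 0 x :=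
      hEi.mul_continuousOn (by
        rw [uIcc_of_le hx.le]
        exact Complex.continuous_ofReal.comp_continuousOn hf)
    have hpi : IntervalIntegrable
        (fun t => E t * (p.eval (Real.cos (Real.pi / x * t)) : ℝ)) volume 0 x :=
      hEi.mul_continuousOn (Continuous.continuousOn (by fun_prop))
    have hle : ‖∫ t in (0 : ℝ)..x, E t * (f t : ℂ)‖ ≤ ∫ t in (0 : ℝ)..x, ‖E t‖ * ε := by
      rw [← sub_zero (∫ t in (0 : ℝ)..x, E t * (f t : ℂ)), ← hp p,
        ← intervalIntegral.integral_sub hfi hpi]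
      refine intervalIntegral.norm_integral_le_of_norm_le hx.le (ae_of_all _ fun t ht => ?_)
        (hEi.norm.mul_const ε)
      rw [← mul_sub, norm_mul, ← Complex.ofReal_sub, Complex.norm_real, Real.norm_eq_abs,
        abs_sub_comm]
      exact mul_le_mul_of_nonneg_left (hclose t ⟨ht.1.le, ht.2⟩).le (norm_nonneg _)
    rw [intervalIntegral.integral_mul_const] at hle
    have hlt : B * ε < (B + 1) * ε := mul_lt_mul_of_pos_right (by linarith) hε
    have heq : (B + 1) * ε = ‖∫ t in (0 : ℝ)..x, E t * (f t : ℂ)‖ := by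
      simp only [ε]; field_simp
    linarith
  have hre := hreal (fun t => (E t).re) (Complex.continuous_re.comp_continuousOn hE)
  have him := hreal (fun t => (E t).im) (Complex.continuous_im.comp_continuousOn hE)
  have hci : ∀ f : ℝ → ℝ, ContinuousOn f (Icc 0 x) →
      IntervalIntegrable (fun t => E t * (f t : ℂ)) volume 0 x := fun f hf =>
    hEi.mul_continuousOn (by
      rw [uIcc_of_le hx.le]
      exact Complex.continuous_ofReal.comp_continuousOn hf)
  -- Testing against Re E and Im E gives the integral of E times its conjugate.
  have hsq : ∫ t in (0 : ℝ)..x, ‖E t‖ ^ 2 = 0 := by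
    have h1 : ((∫ t in (0 : ℝ)..x, ‖E t‖ ^ 2 : ℝ) : ℂ) = 0 := by
      rw [← intervalIntegral.integral_ofReal]
      have h2 : ∀ t, ((‖E t‖ ^ 2 : ℝ) : ℂ) =
          E t * ((E t).re : ℂ) - Complex.I * (E t * ((E t).im : ℂ)) := fun t => by
        rw [← Complex.normSq_eq_norm_sq, ← Complex.mul_conj]
        have h3 : (starRingEnd ℂ) (E t) = (E t).re - Complex.I * (E t).im := by
          apply Complex.ext <;> simp
        rw [h3]
        ring
      simp only [h2]
      rw [intervalIntegral.integral_sub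
        (hci (fun t => (E t).re) (Complex.continuous_re.comp_continuousOn hE))
        ((hci (fun t => (E t).im) (Complex.continuous_im.comp_continuousOn hE)).const_mul _),
        intervalIntegral.integral_const_mul, hre, him, mul_zero, sub_zero]
    exact_mod_cast h1
  by_contra! hne
  obtain ⟨t, ht, hne⟩ := hne
  have := intervalIntegral.integral_pos hx (f := fun t => ‖E t‖ ^ 2) (hE.norm.pow 2)
    (fun t _ => by positivity) ⟨t, ht, by positivity⟩
  linarith

/-- By the product-to-sum formula each factor cos(ct) shifts ρ by ±c, so the induction must run over
all ρ at once. -/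
theorem integral_mul_cos_pow_mul {x c : ℝ} {D : ℝ → ℂ} (hx : 0 ≤ x)
    (hD : ContinuousOn D (Icc 0 x)) {θ : ℂ → ℝ → ℂ} (hθ : ∀ ρ, Continuous (θ ρ))
    (hadd : ∀ ρ t, Real.cos (c * t) * θ ρ t = 1 / 2 * (θ (ρ + c) t + θ (ρ - c) t))
    (h : ∀ ρ, ∫ t in (0 : ℝ)..x, D t * θ ρ t = 0) (n : ℕ) :
    ∀ ρ, ∫ t in (0 : ℝ)..x, D t * θ ρ t * (Real.cos (c * t) ^ n : ℝ) = 0 := by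
  have hDi : IntervalIntegrable D volume 0 x :=
    ContinuousOn.intervalIntegrable (by rwa [uIcc_of_le hx])
  have hi : ∀ ρ (n : ℕ), IntervalIntegrable (fun t => D t * θ ρ t * (Real.cos (c * t) ^ n : ℝ))
      volume 0 x := fun ρ n => by
    have := hθ ρ
    simp only [mul_assoc]
    exact hDi.mul_continuousOn (Continuous.continuousOn (by fun_prop))
  induction n with
  | zero => simpa using h
  | succ n ih =>
    intro ρ
    have h1 : ∀ t, D t * θ ρ t * (Real.cos (c * t) ^ (n + 1) : ℝ) =
        1 / 2 * (D t * θ (ρ + c) t * (Real.cos (c * t) ^ n : ℝ) +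
          D t * θ (ρ - c) t * (Real.cos (c * t) ^ n : ℝ)) := fun t => by
      have := hadd ρ t
      push_cast at this ⊢
      linear_combination (D t * Complex.cos (c * t) ^ n) * this
    simp only [h1]
    rw [intervalIntegral.integral_const_mul, intervalIntegral.integral_add (hi _ _) (hi _ _),
      ih, ih]
    simp

theorem eq_zero_of_integral_mul_cos {x : ℝ} (hx : 0 < x) {D : ℝ → ℂ}
    (hD : ContinuousOn D (Icc 0 x))
    (h : ∀ ρ : ℂ, ∫ t in (0 : ℝ)..x, D t * Complex.cos (ρ * t) = 0) :
    ∀ t ∈ Icc 0 x, D t = 0 := by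
  refine eq_zero_of_integral_mul_cos_pow hx hD fun n => ?_
  have := integral_mul_cos_pow_mul (c := Real.pi / x) hx.le hD
    (θ := fun ρ t => Complex.cos (ρ * t)) (fun ρ => by fun_prop) (fun ρ t => by
      push_cast
      rw [add_mul, sub_mul, Complex.cos_add, Complex.cos_sub]
      ring) h n 0
  simpa using this

/-- The choice ρ = π/x makes D(t) sin(πt/x) orthogonal to all powers of cos(πt/x). The sine is
positive inside the interval, and continuity of D covers the end points. -/
theorem eq_zero_of_integral_mul_sin {x : ℝ} (hx : 0 < x) {D : ℝ → ℂ}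
    (hD : ContinuousOn D (Icc 0 x))
    (h : ∀ ρ : ℂ, ∫ t in (0 : ℝ)..x, D t * Complex.sin (ρ * t) = 0) :
    ∀ t ∈ Icc 0 x, D t = 0 := by
  have h0 := eq_zero_of_integral_mul_cos_pow hx
    (E := fun t => D t * Complex.sin ((Real.pi / x : ℝ) * t))
    (hD.mul (Continuous.continuousOn (by fun_prop)))
    fun n => integral_mul_cos_pow_mul (c := Real.pi / x) hx.le hD
      (θ := fun ρ t => Complex.sin (ρ * t)) (fun ρ => by fun_prop) (fun ρ t => by
        push_cast
        rw [add_mul, sub_mul, Complex.sin_add, Complex.sin_sub]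
        ring) h n _
  have h1 : EqOn D 0 (Ioo 0 x) := fun t ht => by
    refine (mul_eq_zero.1 (h0 t (Ioo_subset_Icc_self ht))).resolve_right ?_
    rw [← Complex.ofReal_mul, ← Complex.ofReal_sin]
    have := Real.sin_pos_of_pos_of_lt_pi (x := Real.pi / x * t) (by have := ht.1; positivity) (by
      rw [div_mul_eq_mul_div, div_lt_iff₀ hx]
      exact mul_lt_mul_of_pos_left ht.2 Real.pi_pos)
    exact_mod_cast this.ne'
  exact h1.of_subset_closure hD continuousOn_const Ioo_subset_Icc_self
    (closure_Ioo hx.ne).ge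

/-! ### Trigonometric solutions and the Wronskian -/

theorem sinDiv_of_ne_zero {ρ : ℂ} (hρ : ρ ≠ 0) (t : ℝ) : sinDiv ρ t = Complex.sin (ρ * t) / ρ := by
  simp [sinDiv, hρ]

theorem mul_sinDiv (ρ : ℂ) (t : ℝ) : ρ * sinDiv ρ t = Complex.sin (ρ * t) := by
  by_cases hρ : ρ = 0
  · simp [hρ]
  · rw [sinDiv_of_ne_zero hρ]; field_simp

theorem sinDiv_zero_right (ρ : ℂ) : sinDiv ρ 0 = 0 := by
  simp [sinDiv]

theorem sinDiv_neg (ρ : ℂ) (t : ℝ) : sinDiv ρ (-t) = -sinDiv ρ t := by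
  by_cases hρ : ρ = 0 <;> simp [sinDiv, hρ, neg_div]

theorem hasDerivAt_sin_mul (ρ : ℂ) (t : ℝ) :
    HasDerivAt (fun t : ℝ => Complex.sin (ρ * t)) (ρ * Complex.cos (ρ * t)) t := by
  have h := (((hasDerivAt_id (t : ℂ)).const_mul ρ).csin).comp_ofReal
  refine h.congr_deriv ?_
  simp [mul_comm]

theorem hasDerivAt_cos_mul (ρ : ℂ) (t : ℝ) :
    HasDerivAt (fun t : ℝ => Complex.cos (ρ * t)) (-(ρ * Complex.sin (ρ * t))) t := by
  have h := (((hasDerivAt_id (t : ℂ)).const_mul ρ).ccos).comp_ofReal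
  refine h.congr_deriv ?_
  simp [mul_comm]

theorem hasDerivAt_sinDiv (ρ : ℂ) (t : ℝ) :
    HasDerivAt (sinDiv ρ) (Complex.cos (ρ * t)) t := by
  by_cases hρ : ρ = 0
  · have : sinDiv ρ = fun t : ℝ => (t : ℂ) := by funext t; simp [sinDiv, hρ]
    rw [this, hρ]
    simpa using (hasDerivAt_id (t : ℂ)).comp_ofReal
  · have : sinDiv ρ = fun t : ℝ => Complex.sin (ρ * t) / ρ := funext (sinDiv_of_ne_zero hρ)
    rw [this]
    refine ((hasDerivAt_sin_mul ρ t).div_const ρ).congr_deriv ?_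
    field_simp

theorem continuous_sinDiv (ρ : ℂ) : Continuous (sinDiv ρ) :=
  continuous_iff_continuousAt.2 fun t => (hasDerivAt_sinDiv ρ t).continuousAt

/-- The Wronskian of two solutions of `y'' = V y` is constant. -/
theorem wronskian_eq {L : ℝ} {V y dy u du : ℝ → ℂ}
    (hy : ∀ x ∈ Icc 0 L, HasDerivWithinAt y (dy x) (Icc 0 L) x) (hdy : ContinuousOn dy (Icc 0 L))
    (hddy : ∀ x ∈ Ioo 0 L, HasDerivAt dy (V x * y x) x)
    (hu : ∀ x, HasDerivAt u (du x) x) (hdu : ∀ x, HasDerivAt du (V x * u x) x) :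
    ∀ x ∈ Icc 0 L, y x * du x - dy x * u x = y 0 * du 0 - dy 0 * u 0 := by
  intro x hx
  have cy : ContinuousOn y (Icc 0 L) := fun x hx => (hy x hx).continuousWithinAt
  have cu : Continuous u := continuous_iff_continuousAt.2 fun x => (hu x).continuousAt
  have cdu : Continuous du := continuous_iff_continuousAt.2 fun x => (hdu x).continuousAt
  have hsub : Icc 0 x ⊆ Icc 0 L := Icc_subset_Icc_right hx.2
  have h := intervalIntegral.integral_eq_sub_of_hasDerivAt_of_le hx.1
    (f := fun x => y x * du x - dy x * u x) (f' := fun _ => 0)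
    (((cy.mul cdu.continuousOn).sub (hdy.mul cu.continuousOn)).mono hsub)
    (fun t ht => by
      have ht' : t ∈ Ioo 0 L := ⟨ht.1, ht.2.trans_le hx.2⟩
      have h1 := (hy t (Ioo_subset_Icc_self ht')).hasDerivAt (Icc_mem_nhds ht'.1 ht'.2)
      refine ((h1.mul (hdu t)).sub ((hddy t ht').mul (hu t))).congr_deriv ?_
      ring)
    intervalIntegrable_const
  rw [intervalIntegral.integral_zero] at h
  exact sub_eq_zero.1 h.symm

/-! ### The sine and cosine kernels -/

/-- The transmutation kernel for the Dirichlet condition at `0`. -/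
def sineKernel (k : ℝ → ℝ → ℂ) (x t : ℝ) : ℂ :=
  k ((x + t) / 2) ((x - t) / 2) - k ((x - t) / 2) ((x + t) / 2)

/-- The transmutation kernel for the condition `y'(0) = h y(0)`. -/
def cosineKernel (h : ℂ) (k : ℝ → ℝ → ℂ) (x t : ℝ) : ℂ :=
  k ((x + t) / 2) ((x - t) / 2) + k ((x - t) / 2) ((x + t) / 2) +
    h * (1 - ∫ s in x..t, sineKernel k x s)

/-- The derivative of a kernel along the line `a + b = x`. -/
def goursatDiag (q : ℝ → ℂ) (k : ℝ → ℝ → ℂ) (x a : ℝ) : ℂ :=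
  goursatFst q k a (x - a) - goursatSnd q k a (x - a)

/-- The derivative in `t` of `sineKernel`. -/
def sineKernelDeriv (q : ℝ → ℂ) (k : ℝ → ℝ → ℂ) (x t : ℝ) : ℂ :=
  1 / 2 * goursatDiag q k x (x / 2 + 1 / 2 * t) + 1 / 2 * goursatDiag q k x (x / 2 + -1 / 2 * t)

/-- The derivative in `t` of `cosineKernel`. -/
def cosineKernelDeriv (h : ℂ) (q : ℝ → ℂ) (k : ℝ → ℝ → ℂ) (x t : ℝ) : ℂ :=
  1 / 2 * goursatDiag q k x (x / 2 + 1 / 2 * t) +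
    -1 / 2 * goursatDiag q k x (x / 2 + -1 / 2 * t) + -h * sineKernel k x t

namespace IsGoursatKernel

variable {q : ℝ → ℂ} {k : ℝ → ℝ → ℂ}

theorem continuous_goursatDiag (hk : IsGoursatKernel q k) (x : ℝ) :
    Continuous (goursatDiag q k x) := by
  have h3 := hk.continuous_fst
  have h4 := hk.continuous_snd
  unfold goursatDiag
  fun_prop

theorem continuous_sineKernel (hk : IsGoursatKernel q k) (x : ℝ) :
    Continuous (sineKernel k x) := by
  have h2 := hk.continuous_kernel
  unfold sineKernel
  fun_prop

theorem continuous_sineKernelDeriv (hk : IsGoursatKernel q k) (x : ℝ) :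
    Continuous (sineKernelDeriv q k x) := by
  have h2 := hk.continuous_goursatDiag x
  unfold sineKernelDeriv
  fun_prop

theorem continuous_cosineKernelDeriv (hk : IsGoursatKernel q k) (h : ℂ) (x : ℝ) :
    Continuous (cosineKernelDeriv h q k x) := by
  have h2 := hk.continuous_goursatDiag x
  have h3 := hk.continuous_sineKernel x
  unfold cosineKernelDeriv
  fun_prop

theorem hasDerivAt_add (hk : IsGoursatKernel q k) (x t : ℝ) :
    HasDerivAt (fun t => k ((x + t) / 2) ((x - t) / 2))
      (1 / 2 * goursatDiag q k x (x / 2 + 1 / 2 * t)) t := by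
  have h1 : HasDerivAt (fun t : ℝ => x / 2 + 1 / 2 * t) (1 / 2) t := by
    exact (((hasDerivAt_id t).const_mul (1 / 2)).const_add (x / 2)).congr_deriv (by norm_num)
  have h2 := (hk.hasDerivAt_diag x (x / 2 + 1 / 2 * t)).scomp t h1
  refine (h2.congr_deriv ?_).congr_of_eventuallyEq (Filter.Eventually.of_forall fun t => ?_)
  · rw [Complex.real_smul, goursatDiag]; push_cast; rfl
  · simp only [Function.comp_apply]
    congr 1 <;> ring

theorem hasDerivAt_sub (hk : IsGoursatKernel q k) (x t : ℝ) :
    HasDerivAt (fun t => k ((x - t) / 2) ((x + t) / 2))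
      (-1 / 2 * goursatDiag q k x (x / 2 + -1 / 2 * t)) t := by
  have h1 : HasDerivAt (fun t : ℝ => x / 2 + -1 / 2 * t) (-1 / 2) t := by
    exact (((hasDerivAt_id t).const_mul (-1 / 2)).const_add (x / 2)).congr_deriv (by norm_num)
  have h2 := (hk.hasDerivAt_diag x (x / 2 + -1 / 2 * t)).scomp t h1
  refine (h2.congr_deriv ?_).congr_of_eventuallyEq (Filter.Eventually.of_forall fun t => ?_)
  · rw [Complex.real_smul, goursatDiag]; push_cast; rfl
  · simp only [Function.comp_apply]
    congr 1 <;> ring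

theorem hasDerivAt_sineKernel (hk : IsGoursatKernel q k) (x t : ℝ) :
    HasDerivAt (sineKernel k x) (sineKernelDeriv q k x t) t := by
  refine ((hk.hasDerivAt_add x t).sub (hk.hasDerivAt_sub x t)).congr_deriv ?_
  rw [sineKernelDeriv]
  ring

theorem hasDerivAt_cosineKernel (hk : IsGoursatKernel q k) (h : ℂ) (x t : ℝ) :
    HasDerivAt (cosineKernel h k x) (cosineKernelDeriv h q k x t) t := by
  refine (((hk.hasDerivAt_add x t).add (hk.hasDerivAt_sub x t)).add
    (((hasDerivAt_integral_of_continuous (hk.continuous_sineKernel x) x t).const_sub 1).const_mul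
      h)).congr_deriv ?_
  rw [cosineKernelDeriv]
  ring

/-- This is where the square integrable derivative of the potential enters: the C¹ remainder does
not spoil the regularity of q/2. -/
theorem exists_hasL2Deriv_goursatDiag (hk : IsGoursatKernel q k) {L : ℝ} {g : ℝ → ℂ}
    (hq : HasL2Deriv 0 L q g) (x : ℝ) : ∃ n, HasL2Deriv 0 L (goursatDiag q k x) n := by
  obtain ⟨R, R', hR', hR, he⟩ := hk.exists_hasDerivAt_remainder x
  exact ⟨_, ((hq.const_mul (1 / 2)).add (HasL2Deriv.of_hasDerivAt hR' hR 0 L)).congr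
    (fun a _ => he a) .rfl⟩

theorem exists_hasL2Deriv_sineKernelDeriv (hk : IsGoursatKernel q k) {L : ℝ} {g : ℝ → ℂ}
    (hq : HasL2Deriv 0 L q g) {x : ℝ} (hx : x ∈ Icc 0 L) :
    ∃ n, HasL2Deriv 0 x (sineKernelDeriv q k x) n := by
  obtain ⟨n, hn⟩ := hk.exists_hasL2Deriv_goursatDiag hq x
  have h1 := hn.comp_affine (c := x / 2) (d := 1 / 2) (l := 0) (r := x) (by norm_num)
    fun t ht => ⟨by linarith [ht.1, ht.2], by linarith [ht.1, ht.2, hx.2]⟩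
  have h2 := hn.comp_affine (c := x / 2) (d := -1 / 2) (l := 0) (r := x) (by norm_num)
    fun t ht => ⟨by linarith [ht.1, ht.2], by linarith [ht.1, ht.2, hx.1, hx.2]⟩
  exact ⟨_, (h1.const_mul (1 / 2)).add (h2.const_mul (1 / 2))⟩

theorem exists_hasL2Deriv_cosineKernelDeriv (hk : IsGoursatKernel q k) {L : ℝ} {g : ℝ → ℂ}
    (hq : HasL2Deriv 0 L q g) (h : ℂ) {x : ℝ} (hx : x ∈ Icc 0 L) :
    ∃ n, HasL2Deriv 0 x (cosineKernelDeriv h q k x) n := by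
  obtain ⟨n, hn⟩ := hk.exists_hasL2Deriv_goursatDiag hq x
  have h1 := hn.comp_affine (c := x / 2) (d := 1 / 2) (l := 0) (r := x) (by norm_num)
    fun t ht => ⟨by linarith [ht.1, ht.2], by linarith [ht.1, ht.2, hx.2]⟩
  have h2 := hn.comp_affine (c := x / 2) (d := -1 / 2) (l := 0) (r := x) (by norm_num)
    fun t ht => ⟨by linarith [ht.1, ht.2], by linarith [ht.1, ht.2, hx.1, hx.2]⟩
  exact ⟨_, ((h1.const_mul (1 / 2)).add (h2.const_mul (-1 / 2))).add
    ((HasL2Deriv.of_hasDerivAt (hk.continuous_sineKernelDeriv x)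
      (hk.hasDerivAt_sineKernel x) 0 x).const_mul (-h))⟩

theorem sineKernel_zero (x : ℝ) : sineKernel k x 0 = 0 := by
  simp [sineKernel]

theorem sineKernel_self (hk : IsGoursatKernel q k) (x : ℝ) : sineKernel k x x = omega q x := by
  simp [sineKernel, hk.apply_zero_right, hk.apply_zero_left]

theorem goursatDiag_self (hk : IsGoursatKernel q k) (x : ℝ) :
    goursatDiag q k x x = 1 / 2 * q x - omega q x ^ 2 := by
  rw [goursatDiag, sub_self, goursatFst_zero_right, hk.goursatSnd_zero_right]

theorem goursatDiag_zero (hk : IsGoursatKernel q k) (x : ℝ) :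
    goursatDiag q k x 0 = 1 / 2 * q 0 := by
  rw [goursatDiag, hk.goursatFst_zero_left, goursatSnd_zero_left, sub_zero]

/-- The point t = x corresponds to a = x and, for the reflected term, to a = 0; hence the values
q(x) and q(0) in the expansion. -/
theorem sineKernelDeriv_self (hk : IsGoursatKernel q k) (x : ℝ) :
    sineKernelDeriv q k x x = 1 / 4 * (q x - 2 * omega q x ^ 2 + q 0) := by
  rw [sineKernelDeriv, show x / 2 + 1 / 2 * x = x by ring, show x / 2 + -1 / 2 * x = 0 by ring,
    hk.goursatDiag_self, hk.goursatDiag_zero]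
  ring

theorem cosineKernel_self (hk : IsGoursatKernel q k) (h : ℂ) (x : ℝ) :
    cosineKernel h k x x = h + omega q x := by
  simp [cosineKernel, hk.apply_zero_right, hk.apply_zero_left, add_comm]

theorem cosineKernelDeriv_self (hk : IsGoursatKernel q k) (h : ℂ) (x : ℝ) :
    cosineKernelDeriv h q k x x =
      1 / 4 * (q x - 4 * h * omega q x - 2 * omega q x ^ 2 - q 0) := by
  rw [cosineKernelDeriv, show x / 2 + 1 / 2 * x = x by ring, show x / 2 + -1 / 2 * x = 0 by ring,
    hk.goursatDiag_self, hk.goursatDiag_zero, hk.sineKernel_self]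
  ring

theorem cosineKernelDeriv_zero (h : ℂ) (x : ℝ) : cosineKernelDeriv h q k x 0 = 0 := by
  rw [cosineKernelDeriv, sineKernel_zero, mul_zero, mul_zero]
  ring

/-- A fundamental system of `y'' = (q - ρ²) y` in terms of the kernels. -/
theorem exists_fundamentalSystem (hk : IsGoursatKernel q k) (ρ : ℂ) :
    ∃ s ds c dc : ℝ → ℂ,
      (∀ x, HasDerivAt s (ds x) x) ∧ (∀ x, HasDerivAt ds ((q x - ρ ^ 2) * s x) x) ∧
      (∀ x, HasDerivAt c (dc x) x) ∧ (∀ x, HasDerivAt dc ((q x - ρ ^ 2) * c x) x) ∧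
      s 0 = 0 ∧ ds 0 = 1 ∧ c 0 = 1 ∧ dc 0 = 0 ∧
      (∀ x, s x = sinDiv ρ x + ∫ t in (0 : ℝ)..x, sineKernel k x t * sinDiv ρ t) ∧
      ∀ x, 0 ≤ x → ∀ h : ℂ, c x + h * s x = Complex.cos (ρ * x) +
        ∫ t in (0 : ℝ)..x, cosineKernel h k x t * Complex.cos (ρ * t) := by
  have hcos : ∀ t : ℝ, HasDerivAt (fun t : ℝ => Complex.cos (ρ * t)) (-ρ ^ 2 * sinDiv ρ t) t :=
    fun t => (hasDerivAt_cos_mul ρ t).congr_deriv (by rw [← mul_sinDiv]; ring)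
  have hsin : ∀ t : ℝ, HasDerivAt (fun t : ℝ => -ρ ^ 2 * sinDiv ρ t)
      (-ρ ^ 2 * Complex.cos (ρ * t)) t := fun t => (hasDerivAt_sinDiv ρ t).const_mul _
  have hs := hk.hasDerivAt_transmutation (hasDerivAt_sinDiv ρ) hcos
  have hc := hk.hasDerivAt_transmutation hcos hsin
  have es : ∀ x, sinDiv ρ x + 2 * ∫ a in (0 : ℝ)..x, k a (x - a) * sinDiv ρ (2 * a - x) =
      sinDiv ρ x + ∫ t in (0 : ℝ)..x, sineKernel k x t * sinDiv ρ t := fun x => by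
    rw [hk.transmutation_eq (continuous_sinDiv ρ)]
    congr 1
    refine intervalIntegral.integral_congr fun t _ => ?_
    simp only [sineKernel, sinDiv_neg]
    ring
  refine ⟨_, _, _, _, fun x => (hs x).1, fun x => (hs x).2.congr_deriv (by ring),
    fun x => (hc x).1, fun x => (hc x).2.congr_deriv (by ring), ?_, ?_, ?_, ?_, es, ?_⟩
  · simp [sinDiv_zero_right]
  · simp
  · simp
  · simp [sinDiv_zero_right]
  · intro x hx h
    have hS := hk.continuous_sineKernel x
    have hk2 := hk.continuous_kernel
    -- The primitive of -`sineKernel` in t that equals 1 at t = x is chosen, so that the boundary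
    -- term reproduces sin(ρx)/ρ and all of h S becomes a cosine integral.
    have hparts := (HasL2Deriv.of_hasDerivAt (f := fun t => 1 - ∫ s in x..t, sineKernel k x s)
      (g := fun t => -sineKernel k x t) (by fun_prop)
      (fun t => (hasDerivAt_integral_of_continuous hS x t).const_sub 1) 0 x).integral_mul_deriv
      hx (hasDerivAt_sinDiv ρ) (by fun_prop)
    simp only [intervalIntegral.integral_same, sub_zero, one_mul, sinDiv_zero_right, mul_zero,
      neg_mul, intervalIntegral.integral_neg, sub_neg_eq_add] at hparts
    rw [es, ← hparts, hk.transmutation_eq (θ := fun t : ℝ => Complex.cos (ρ * t)) (by fun_prop),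
      add_assoc, ← intervalIntegral.integral_const_mul, ← intervalIntegral.integral_add
        (Continuous.intervalIntegrable (by fun_prop) _ _)
        (Continuous.intervalIntegrable (by fun_prop) _ _)]
    congr 1
    refine intervalIntegral.integral_congr fun t _ => ?_
    simp only [cosineKernel, Complex.ofReal_neg, mul_neg, Complex.cos_neg]
    ring

end IsGoursatKernel

/-! ### Representation of solutions, expansion and uniqueness of kernels -/

/-- Solutions of `-y'' + p y = ρ² y` on `[0, L]` in terms of a fundamental system for an
extension `q` of `p`. -/
theorem IsSolution.eq_fundamentalSystem {L : ℝ} {p q : ℝ → ℂ} (hp : EqOn p q (Icc 0 L))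
    {ρ y₀ y₁ : ℂ} {y : ℝ → ℂ} (hy : IsSolution L p ρ y₀ y₁ y) {s ds c dc : ℝ → ℂ}
    (hs : ∀ x, HasDerivAt s (ds x) x) (hds : ∀ x, HasDerivAt ds ((q x - ρ ^ 2) * s x) x)
    (hc : ∀ x, HasDerivAt c (dc x) x) (hdc : ∀ x, HasDerivAt dc ((q x - ρ ^ 2) * c x) x)
    (hs0 : s 0 = 0) (hds0 : ds 0 = 1) (hc0 : c 0 = 1) (hdc0 : dc 0 = 0) :
    ∀ x ∈ Icc 0 L, y x = y₀ * c x + y₁ * s x := by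
  obtain ⟨dy, ddy, h1, h2, h3, h4, h5, h6⟩ := hy
  intro x hx
  have h3' : ∀ x ∈ Ioo 0 L, HasDerivAt dy ((q x - ρ ^ 2) * y x) x := fun x hx => by
    refine (h3 x hx).congr_deriv ?_
    rw [← hp (Ioo_subset_Icc_self hx)]
    linear_combination -(h4 x hx)
  have w1 := wronskian_eq h1 h2 h3' hs hds x hx
  have w2 := wronskian_eq h1 h2 h3' hc hdc x hx
  have w3 := wronskian_eq (L := L) (fun x _ => (hc x).hasDerivWithinAt)
    (fun x _ => (hdc x).continuousAt.continuousWithinAt) (fun x _ => hdc x) hs hds x hx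
  rw [hs0, hds0, h5, h6] at w1
  rw [hc0, hdc0, h5, h6] at w2
  rw [hs0, hds0, hc0, hdc0] at w3
  -- Cramer's rule: `w1` and `w2` are linear in y and y', with determinant 1 by `w3`.
  linear_combination c x * w1 - s x * w2 - y x * w3

/-- Two integrations by parts. At t = 0 the first boundary term needs κ(0) = 0, while the second
vanishes with the sine; in the cosine analogue the roles are exchanged and κ'(0) = 0 is needed. -/
theorem integral_mul_sin {x : ℝ} (hx : 0 ≤ x) {κ κ' g : ℝ → ℂ}
    (hκ : ∀ t, HasDerivAt κ (κ' t) t) (hκ' : Continuous κ') (hg : HasL2Deriv 0 x κ' g)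
    {ρ : ℂ} (hρ : ρ ≠ 0) (h0 : κ 0 = 0) :
    ∫ t in (0 : ℝ)..x, κ t * Complex.sin (ρ * t) = -κ x * Complex.cos (ρ * x) / ρ +
      κ' x * Complex.sin (ρ * x) / ρ ^ 2 -
        1 / ρ ^ 2 * ∫ t in (0 : ℝ)..x, g t * Complex.sin (ρ * t) := by
  have h1 := (HasL2Deriv.of_hasDerivAt hκ' hκ 0 x).integral_mul_deriv hx
    (hasDerivAt_cos_mul ρ) (by fun_prop)
  have h2 := hg.integral_mul_deriv hx (hasDerivAt_sin_mul ρ) (by fun_prop)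
  simp only [mul_neg, intervalIntegral.integral_neg, mul_left_comm _ ρ,
    intervalIntegral.integral_const_mul] at h1 h2
  simp only [h0, Complex.ofReal_zero, mul_zero, Complex.sin_zero, zero_mul, sub_zero] at h1 h2
  field_simp
  linear_combination -ρ * h1 + h2

theorem integral_mul_cos {x : ℝ} (hx : 0 ≤ x) {κ κ' g : ℝ → ℂ}
    (hκ : ∀ t, HasDerivAt κ (κ' t) t) (hκ' : Continuous κ') (hg : HasL2Deriv 0 x κ' g)
    {ρ : ℂ} (hρ : ρ ≠ 0) (h0 : κ' 0 = 0) :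
    ∫ t in (0 : ℝ)..x, κ t * Complex.cos (ρ * t) = κ x * Complex.sin (ρ * x) / ρ +
      κ' x * Complex.cos (ρ * x) / ρ ^ 2 -
        1 / ρ ^ 2 * ∫ t in (0 : ℝ)..x, g t * Complex.cos (ρ * t) := by
  have h1 := (HasL2Deriv.of_hasDerivAt hκ' hκ 0 x).integral_mul_deriv hx
    (hasDerivAt_sin_mul ρ) (by fun_prop)
  have h2 := hg.integral_mul_deriv hx (hasDerivAt_cos_mul ρ) (by fun_prop)
  simp only [mul_neg, intervalIntegral.integral_neg, mul_left_comm _ ρ,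
    intervalIntegral.integral_const_mul] at h1 h2
  simp only [h0, Complex.ofReal_zero, mul_zero, Complex.sin_zero, zero_mul, sub_zero] at h1 h2
  field_simp
  linear_combination ρ * h1 + h2

theorem differentiableOn_and_hasL2Deriv_partial2 {x : ℝ} (hx : 0 ≤ x) {K : ℝ → ℝ → ℂ}
    {κ κ' g : ℝ → ℂ} (hK : EqOn (K x) κ (Icc 0 x)) (hκ : ∀ t, HasDerivAt κ (κ' t) t)
    (hg : HasL2Deriv 0 x κ' g) :
    DifferentiableOn ℝ (K x) (Icc 0 x) ∧ HasL2Deriv 0 x (partial2 K x) (partial22 K x) ∧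
      ∀ f : ℝ → ℂ, ∫ t in (0 : ℝ)..x, partial22 K x t * f t = ∫ t in (0 : ℝ)..x, g t * f t := by
  have hd : ∀ t ∈ Icc 0 x, HasDerivWithinAt (K x) (κ' t) (Icc 0 x) t := fun t ht =>
    (hκ t).hasDerivWithinAt.congr hK (hK ht)
  refine ⟨fun t ht => (hd t ht).differentiableWithinAt, ?_⟩
  -- On the one-point interval derivatives within it are not unique, but the measure is zero and all
  -- assertions are trivial.
  rcases hx.eq_or_lt with rfl | hx
  · refine ⟨⟨?_, fun t ht => ?_⟩, by simp⟩
    · rw [Icc_self, Measure.restrict_eq_zero.2 (measure_singleton _)]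
      exact memLp_measure_zero
    · obtain rfl : t = 0 := by simpa using ht
      simp
  · have hp : EqOn (partial2 K x) κ' (Icc 0 x) := fun t ht =>
      (hd t ht).derivWithin (uniqueDiffOn_Icc hx t ht)
    have h1 : HasL2Deriv 0 x (partial2 K x) g := hg.congr hp .rfl
    refine ⟨h1.hasL2Deriv_derivWithin, fun f => intervalIntegral.integral_congr_ae ?_⟩
    filter_upwards [(ae_restrict_iff' measurableSet_Icc).1 h1.derivWithin_ae_eq] with t ht hm
    rw [uIoc_of_le hx.le] at hm
    have := ht ⟨hm.1.le, hm.2⟩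
    rw [← this]
    rfl

theorem IsSineKernel.eqOn {L : ℝ} {S : ℂ → ℝ → ℂ} {K K' : ℝ → ℝ → ℂ} (hK : IsSineKernel L S K)
    (hK' : IsSineKernel L S K') {x : ℝ} (hx : x ∈ Ioc 0 L) : EqOn (K x) (K' x) (Icc 0 x) := by
  obtain ⟨h1, h2⟩ := hK x ⟨hx.1.le, hx.2⟩
  obtain ⟨h1', h2'⟩ := hK' x ⟨hx.1.le, hx.2⟩
  have hi : ∀ {f : ℝ → ℂ} (ρ : ℂ), ContinuousOn f (Icc 0 x) →
      IntervalIntegrable (fun t => f t * sinDiv ρ t) volume 0 x := fun ρ hf =>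
    ContinuousOn.intervalIntegrable (by
      rw [uIcc_of_le hx.1.le]; exact hf.mul (continuous_sinDiv ρ).continuousOn)
  refine fun t ht => sub_eq_zero.1 (eq_zero_of_integral_mul_sin hx.1
    (D := fun t => K x t - K' x t) (h1.continuousOn.sub h1'.continuousOn) (fun ρ => ?_) t ht)
  -- Multiplying the kernel identity by ρ replaces sin(ρt)/ρ by sin(ρt) and treats ρ = 0 uniformly.
  simp only [← mul_sinDiv, mul_left_comm _ ρ, sub_mul]
  rw [intervalIntegral.integral_const_mul,
    intervalIntegral.integral_sub (hi ρ h1.continuousOn) (hi ρ h1'.continuousOn)]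
  linear_combination ρ * (h2' ρ - h2 ρ)

theorem IsCosineKernel.eqOn {L : ℝ} {S : ℂ → ℝ → ℂ} {K K' : ℝ → ℝ → ℂ}
    (hK : IsCosineKernel L S K) (hK' : IsCosineKernel L S K') {x : ℝ} (hx : x ∈ Ioc 0 L) :
    EqOn (K x) (K' x) (Icc 0 x) := by
  obtain ⟨h1, h2⟩ := hK x ⟨hx.1.le, hx.2⟩
  obtain ⟨h1', h2'⟩ := hK' x ⟨hx.1.le, hx.2⟩
  have hi : ∀ {f : ℝ → ℂ} (ρ : ℂ), ContinuousOn f (Icc 0 x) →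
      IntervalIntegrable (fun t => f t * Complex.cos (ρ * t)) volume 0 x := fun ρ hf =>
    ContinuousOn.intervalIntegrable (by
      rw [uIcc_of_le hx.1.le]; exact hf.mul (Continuous.continuousOn (by fun_prop)))
  refine fun t ht => sub_eq_zero.1 (eq_zero_of_integral_mul_cos hx.1
    (D := fun t => K x t - K' x t) (h1.continuousOn.sub h1'.continuousOn) (fun ρ => ?_) t ht)
  simp only [sub_mul]
  rw [intervalIntegral.integral_sub (hi ρ h1.continuousOn) (hi ρ h1'.continuousOn)]
  linear_combination h2' ρ - h2 ρ

/-- The potential has a bounded continuous extension, which has a kernel. -/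
theorem MemW21.exists_isGoursatKernel {L : ℝ} (hL : 0 < L) {q : ℝ → ℂ} (hq : MemW21 0 L q) :
    ∃ p k, EqOn q p (Icc 0 L) ∧ IsGoursatKernel p k := by
  have hc := hq.continuousOn
  obtain ⟨Q, hQ⟩ := isCompact_Icc.exists_bound_of_continuousOn hc
  have hp : ∀ s, ‖IccExtend hL.le ((Icc 0 L).domRestrict q) s‖ ≤ Q := fun s =>
    hQ _ (projIcc 0 L hL.le s).2
  obtain ⟨k, hk⟩ := SturmLiouville.exists_isGoursatKernel
    (continuousOn_iff_continuous_domRestrict.1 hc).Icc_extend' hp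
  exact ⟨_, k, fun x hx => (IccExtend_of_mem hL.le ((Icc 0 L).domRestrict q) hx).symm, hk⟩

theorem omega_congr {L : ℝ} {q p : ℝ → ℂ} (h : EqOn q p (Icc 0 L)) {x : ℝ} (hx : x ∈ Icc 0 L) :
    omega q x = omega p x := by
  unfold omega
  congr 1
  refine intervalIntegral.integral_congr fun t ht => h ?_
  rw [uIcc_of_le hx.1] at ht
  exact ⟨ht.1, ht.2.trans hx.2⟩

namespace IsGoursatKernel

variable {L : ℝ} {q p : ℝ → ℂ} {k : ℝ → ℝ → ℂ}

theorem isSineKernel (hk : IsGoursatKernel p k) (hp : EqOn q p (Icc 0 L)) {S : ℂ → ℝ → ℂ}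
    (hS : ∀ ρ : ℂ, IsSolution L q ρ 0 1 (S ρ)) : IsSineKernel L S (sineKernel k) := by
  refine fun x hx => ⟨⟨_, HasL2Deriv.of_hasDerivAt (hk.continuous_sineKernelDeriv x)
    (hk.hasDerivAt_sineKernel x) 0 x⟩, fun ρ => ?_⟩
  obtain ⟨s, ds, c, dc, hs, hds, hc, hdc, hs0, hds0, hc0, hdc0, he, -⟩ :=
    hk.exists_fundamentalSystem ρ
  rw [(hS ρ).eq_fundamentalSystem hp hs hds hc hdc hs0 hds0 hc0 hdc0 x hx, zero_mul, zero_add,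
    one_mul, he]

theorem isCosineKernel (hk : IsGoursatKernel p k) (hp : EqOn q p (Icc 0 L)) {h : ℂ}
    {φ : ℂ → ℝ → ℂ} (hφ : ∀ ρ : ℂ, IsSolution L q ρ 1 h (φ ρ)) :
    IsCosineKernel L φ (cosineKernel h k) := by
  refine fun x hx => ⟨⟨_, HasL2Deriv.of_hasDerivAt (hk.continuous_cosineKernelDeriv h x)
    (hk.hasDerivAt_cosineKernel h x) 0 x⟩, fun ρ => ?_⟩
  obtain ⟨s, ds, c, dc, hs, hds, hc, hdc, hs0, hds0, hc0, hdc0, -, he⟩ :=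
    hk.exists_fundamentalSystem ρ
  rw [(hφ ρ).eq_fundamentalSystem hp hs hds hc hdc hs0 hds0 hc0 hdc0 x hx, one_mul, he x hx.1]

end IsGoursatKernel

end SturmLiouville

end

/-! ### The main theorem -/

theorem mainTheorem3 (L : ℝ) (hL : 0 < L) (q : ℝ → ℂ) (hq : SturmLiouville.MemW21 0 L q)
    (h : ℂ) (S φ : ℂ → ℝ → ℂ)
    (hS : ∀ ρ : ℂ, SturmLiouville.IsSolution L q ρ 0 1 (S ρ))
    (hφ : ∀ ρ : ℂ, SturmLiouville.IsSolution L q ρ 1 h (φ ρ)) :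
    (∃ K : ℝ → ℝ → ℂ, SturmLiouville.IsSineKernel L S K) ∧
    (∃ K : ℝ → ℝ → ℂ, SturmLiouville.IsCosineKernel L φ K) ∧
    (∀ K : ℝ → ℝ → ℂ, SturmLiouville.IsSineKernel L S K → ∀ x ∈ Set.Icc 0 L,
      DifferentiableOn ℝ (K x) (Set.Icc 0 x) ∧
      SturmLiouville.HasL2Deriv 0 x (SturmLiouville.partial2 K x)
        (SturmLiouville.partial22 K x) ∧
      ∀ ρ : ℂ, ρ ≠ 0 →
        S ρ x = Complex.sin (ρ * x) / ρ
          - Complex.cos (ρ * x) / ρ ^ 2 * SturmLiouville.omega q x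
          + Complex.sin (ρ * x) / (4 * ρ ^ 3)
              * (q x - 2 * SturmLiouville.omega q x ^ 2 + q 0)
          - 1 / ρ ^ 3 * ∫ t in (0 : ℝ)..x,
              SturmLiouville.partial22 K x t * Complex.sin (ρ * t)) ∧
    (∀ K : ℝ → ℝ → ℂ, SturmLiouville.IsCosineKernel L φ K → ∀ x ∈ Set.Icc 0 L,
      DifferentiableOn ℝ (K x) (Set.Icc 0 x) ∧
      SturmLiouville.HasL2Deriv 0 x (SturmLiouville.partial2 K x)
        (SturmLiouville.partial22 K x) ∧
      ∀ ρ : ℂ, ρ ≠ 0 →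
        φ ρ x = Complex.cos (ρ * x)
          + Complex.sin (ρ * x) / ρ * (h + SturmLiouville.omega q x)
          + Complex.cos (ρ * x) / (4 * ρ ^ 2)
              * (q x - 4 * h * SturmLiouville.omega q x
                  - 2 * SturmLiouville.omega q x ^ 2 - q 0)
          - 1 / ρ ^ 2 * ∫ t in (0 : ℝ)..x,
              SturmLiouville.partial22 K x t * Complex.cos (ρ * t)) := by
  obtain ⟨p, k, hp, hk⟩ := hq.exists_isGoursatKernel hL
  obtain ⟨g, hg⟩ := hq
  replace hg : SturmLiouville.HasL2Deriv 0 L p g := hg.congr hp.symm .rfl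
  have hsin := hk.isSineKernel hp hS
  have hcos := hk.isCosineKernel hp hφ
  have h0 : (0 : ℝ) ∈ Set.Icc 0 L := ⟨le_rfl, hL.le⟩
  -- At x = 0 the integral identity does not determine K(0, 0), so uniqueness is unavailable.
  -- Regularity is trivial there, and the expansions reduce to the initial values.
  have hsing : ∀ K : ℝ → ℝ → ℂ, DifferentiableOn ℝ (K 0) (Set.Icc 0 0) ∧
      SturmLiouville.HasL2Deriv 0 0 (SturmLiouville.partial2 K 0)
        (SturmLiouville.partial22 K 0) := fun K => by
    have := SturmLiouville.differentiableOn_and_hasL2Deriv_partial2 le_rfl (K := K)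
      (κ := fun _ => K 0 0) (fun t ht => by
        obtain rfl : t = 0 := by simpa using ht
        rfl) (fun t => hasDerivAt_const t _)
      (SturmLiouville.HasL2Deriv.of_hasDerivAt continuous_const
        (fun t => hasDerivAt_const t _) 0 0)
    exact ⟨this.1, this.2.1⟩
  refine ⟨⟨_, hsin⟩, ⟨_, hcos⟩, fun K hK x hx => ?_, fun K hK x hx => ?_⟩
  · rcases hx.1.eq_or_lt with rfl | hx0
    · refine ⟨(hsing K).1, (hsing K).2, fun ρ _ => ?_⟩
      obtain ⟨_, _, _, _, _, _, h1, _⟩ := hS ρ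
      simp [h1, SturmLiouville.omega]
    · obtain ⟨n, hn⟩ := hk.exists_hasL2Deriv_sineKernelDeriv hg hx
      obtain ⟨h1, h2, h3⟩ := SturmLiouville.differentiableOn_and_hasL2Deriv_partial2 hx.1
        (hK.eqOn hsin ⟨hx0, hx.2⟩) (hk.hasDerivAt_sineKernel x) hn
      refine ⟨h1, h2, fun ρ hρ => ?_⟩
      have h4 := SturmLiouville.integral_mul_sin hx.1 (hk.hasDerivAt_sineKernel x)
        (hk.continuous_sineKernelDeriv x) hn hρ (SturmLiouville.IsGoursatKernel.sineKernel_zero x)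
      rw [hk.sineKernel_self, hk.sineKernelDeriv_self] at h4
      rw [(hsin x hx).2 ρ, h3, SturmLiouville.omega_congr hp hx, hp hx, hp h0]
      simp only [SturmLiouville.sinDiv_of_ne_zero hρ, ← mul_div_assoc]
      rw [intervalIntegral.integral_div, h4]
      field_simp
      ring
  · rcases hx.1.eq_or_lt with rfl | hx0
    · refine ⟨(hsing K).1, (hsing K).2, fun ρ _ => ?_⟩
      obtain ⟨_, _, _, _, _, _, h1, _⟩ := hφ ρ
      simp [h1, SturmLiouville.omega]
    · obtain ⟨n, hn⟩ := hk.exists_hasL2Deriv_cosineKernelDeriv hg h hx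
      obtain ⟨h1, h2, h3⟩ := SturmLiouville.differentiableOn_and_hasL2Deriv_partial2 hx.1
        (hK.eqOn hcos ⟨hx0, hx.2⟩) (hk.hasDerivAt_cosineKernel h x) hn
      refine ⟨h1, h2, fun ρ hρ => ?_⟩
      have h4 := SturmLiouville.integral_mul_cos hx.1 (hk.hasDerivAt_cosineKernel h x)
        (hk.continuous_cosineKernelDeriv h x) hn hρ
        (SturmLiouville.IsGoursatKernel.cosineKernelDeriv_zero h x)
      rw [hk.cosineKernel_self, hk.cosineKernelDeriv_self] at h4
      rw [(hcos x hx).2 ρ, h3, SturmLiouville.omega_congr hp hx, hp hx, hp h0, h4]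
      field_simp
      ring
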